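/- Let $n\ge 1$, let $\Omega\subset\mathbb R^n$ be a bounded domain (connected, non-empty, open set) of class $C^1$, let $\varphi:\overline\Omega\to\mathbb R$ (the obstacle) and $f:\partial\Omega\to\mathbb R$ (the boundary datum) be functions of class $C^1$ with $\varphi\le f$ on $\partial\Omega$, and let $u\in W^{1,2}(\Omega)$ be the minimizer of the Dirichlet integral $$\int_\Omega \frac{|\nabla w|^2}{2}$$ among all $w\in W^{1,2}(\Omega)$ with $w|_{\partial\Omega}=f$ in the sense of traces and $w\ge\varphi$ almost everywhere in $\Omega$. Assume that $\varphi\in C^{1,1}(\Omega)$, that is, $\nabla\varphi$ is Lipschitz on $\Omega$. Then, for every $x\in\Omega$, the limit $\hat u(x)=\lim_{r\to 0^+}\frac{1}{|B_r(x)|}\int_{B_r(x)}u$ exists, $\hat u=u$ almost everywhere in $\Omega$, and, identifying $u$ with its representative $\hat u$, the function $v=u-\varphi$, and hence also $u$, belongs to $C^{1,1}_{\rm loc}(\Omega)$: $v$ and $u$ are of class $C^1$ in $\Omega$, and their gradients are Lipschitz on every compact subset of $\Omega$. -/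

import Mathlib

open MeasureTheory Filter Topology
open scoped ContDiff NNReal

namespace ObstacleProblem

/-- `Ω` is a bounded domain of class `C¹` in `ℝⁿ`: a bounded, connected (non-empty) open set which
near each of its boundary points is the sublevel set `{ρ < 0}` of a `C¹` function `ρ`
with non-vanishing differential. -/
structure IsBoundedC1Domain {n : ℕ} (Ω : Set (EuclideanSpace ℝ (Fin n))) : Prop where
  isOpen : IsOpen Ω
  isConnected : IsConnected Ω
  isBounded : Bornology.IsBounded Ω
  boundary : ∀ x₀ ∈ frontier Ω, ∃ (U : Set (EuclideanSpace ℝ (Fin n)))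
    (ρ : EuclideanSpace ℝ (Fin n) → ℝ), IsOpen U ∧ x₀ ∈ U ∧ ContDiffOn ℝ 1 ρ U ∧
      (∀ x ∈ U, fderiv ℝ ρ x ≠ 0) ∧ Ω ∩ U = {x ∈ U | ρ x < 0}

/-- `w ∈ C^{1,1}(Ω)`, for an open set `Ω`: `w` is `C¹` and its derivative is Lipschitz on `Ω`. -/
def IsC11On {n : ℕ} (w : EuclideanSpace ℝ (Fin n) → ℝ) (Ω : Set (EuclideanSpace ℝ (Fin n))) :
    Prop :=
  ContDiffOn ℝ 1 w Ω ∧ ∃ C : ℝ≥0, LipschitzOnWith C (fderiv ℝ w) Ω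

/-- `w ∈ C^{1,1}_loc(Ω)`, for an open set `Ω`: `w` is `C¹` on `Ω` and its derivative is Lipschitz
on every compact subset of `Ω`. -/
def IsC11LocOn {n : ℕ} (w : EuclideanSpace ℝ (Fin n) → ℝ) (Ω : Set (EuclideanSpace ℝ (Fin n))) :
    Prop :=
  ContDiffOn ℝ 1 w Ω ∧
    ∀ K : Set (EuclideanSpace ℝ (Fin n)), IsCompact K → K ⊆ Ω →
      ∃ C : ℝ≥0, LipschitzOnWith C (fderiv ℝ w) K

/-- `g` is the weak gradient of `w` in `Ω`:
`∫_Ω w ∂_e ψ = - ∫_Ω (g · e) ψ` for all `ψ ∈ C_c^∞(Ω)` and all directions `e`. -/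
def IsWeakGradient {n : ℕ} (Ω : Set (EuclideanSpace ℝ (Fin n)))
    (w : EuclideanSpace ℝ (Fin n) → ℝ)
    (g : EuclideanSpace ℝ (Fin n) → EuclideanSpace ℝ (Fin n)) : Prop :=
  ∀ ψ : EuclideanSpace ℝ (Fin n) → ℝ, ContDiff ℝ ∞ ψ → HasCompactSupport ψ → tsupport ψ ⊆ Ω →
    ∀ e : EuclideanSpace ℝ (Fin n),
      ∫ x in Ω, w x * fderiv ℝ ψ x e = - ∫ x in Ω, inner ℝ (g x) e * ψ x

/-- `w ∈ W^{1,2}(Ω)`, with weak gradient `g`. -/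
structure IsW12 {n : ℕ} (Ω : Set (EuclideanSpace ℝ (Fin n)))
    (w : EuclideanSpace ℝ (Fin n) → ℝ)
    (g : EuclideanSpace ℝ (Fin n) → EuclideanSpace ℝ (Fin n)) : Prop where
  memLp : MemLp w 2 (volume.restrict Ω)
  memLp_grad : MemLp g 2 (volume.restrict Ω)
  isWeakGradient : IsWeakGradient Ω w g

/-- For `w ∈ W^{1,2}(Ω)` with weak gradient `g`: the trace of `w` on `∂Ω` is `f`. The trace operator
`W^{1,2}(Ω) → L²(∂Ω, 𝓗^{n-1})` is the continuous extension of the restriction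
`W ↦ W|_{∂Ω}` of functions that are `C¹` up to the boundary; thus `w` has trace `f` when some `C¹`
functions `W k` converge to `w` in `W^{1,2}(Ω)` and to `f` in `L²(∂Ω, 𝓗^{n-1})`. -/
def HasTrace {n : ℕ} (Ω : Set (EuclideanSpace ℝ (Fin n)))
    (w : EuclideanSpace ℝ (Fin n) → ℝ)
    (g : EuclideanSpace ℝ (Fin n) → EuclideanSpace ℝ (Fin n))
    (f : EuclideanSpace ℝ (Fin n) → ℝ) : Prop :=
  ∃ W : ℕ → EuclideanSpace ℝ (Fin n) → ℝ, (∀ k, ContDiff ℝ 1 (W k)) ∧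
    Tendsto (fun k => eLpNorm (fun x => W k x - w x) 2 (volume.restrict Ω)) atTop (𝓝 0) ∧
    Tendsto (fun k => eLpNorm (fun x => gradient (W k) x - g x) 2 (volume.restrict Ω))
      atTop (𝓝 0) ∧
    Tendsto (fun k => eLpNorm (fun x => W k x - f x) 2
      ((Measure.hausdorffMeasure ((n : ℝ) - 1)).restrict (frontier Ω))) atTop (𝓝 0)

/-- `w`, with weak gradient `g`, is a competitor in the obstacle problem in `Ω` with obstacle `φ`
and boundary datum `f`: `w ∈ W^{1,2}(Ω)`, `w|_{∂Ω} = f` in the sense of traces, and `w ≥ φ`. -/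
structure IsAdmissible {n : ℕ} (Ω : Set (EuclideanSpace ℝ (Fin n)))
    (φ f : EuclideanSpace ℝ (Fin n) → ℝ) (w : EuclideanSpace ℝ (Fin n) → ℝ)
    (g : EuclideanSpace ℝ (Fin n) → EuclideanSpace ℝ (Fin n)) : Prop where
  isW12 : IsW12 Ω w g
  hasTrace : HasTrace Ω w g f
  obstacle_le : ∀ᵐ x ∂(volume.restrict Ω), φ x ≤ w x

/-- `u` minimizes the Dirichlet integral `∫_Ω |∇w|² / 2` among all `w ∈ W^{1,2}(Ω)`
with `w|_{∂Ω} = f` and `w ≥ φ`. -/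
def IsMinimizer {n : ℕ} (Ω : Set (EuclideanSpace ℝ (Fin n)))
    (φ f : EuclideanSpace ℝ (Fin n) → ℝ) (u : EuclideanSpace ℝ (Fin n) → ℝ) : Prop :=
  ∃ gu : EuclideanSpace ℝ (Fin n) → EuclideanSpace ℝ (Fin n), IsAdmissible Ω φ f u gu ∧
    ∀ (w : EuclideanSpace ℝ (Fin n) → ℝ)
      (gw : EuclideanSpace ℝ (Fin n) → EuclideanSpace ℝ (Fin n)), IsAdmissible Ω φ f w gw →
      ∫ x in Ω, ‖gu x‖ ^ 2 / 2 ≤ ∫ x in Ω, ‖gw x‖ ^ 2 / 2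

/-- `u'` is the representative of `u` in `Ω` given at every point of `Ω` by
`u' x = lim_{r → 0} ⨍_{B_r(x)} u` (the limit existing), and `u' = u` almost everywhere in `Ω`. -/
def IsPreciseRepresentative {n : ℕ} (Ω : Set (EuclideanSpace ℝ (Fin n)))
    (u u' : EuclideanSpace ℝ (Fin n) → ℝ) : Prop :=
  (∀ x ∈ Ω, Tendsto (fun r : ℝ => ⨍ y in Metric.ball x r, u y) (𝓝[>] 0) (𝓝 (u' x))) ∧
    u' =ᵐ[volume.restrict Ω] u

end ObstacleProblem

/-! Write `L` for the Lipschitz constant of `∇φ`. The minimizer `u` satisfies `-nL ≤ Δu ≤ 0` weakly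
in `Ω`. The upper bound holds because `u + tψ` stays above the obstacle when `ψ ≥ 0`. For the lower
bound (`integral_inner_gradient_le_of_isMinimizer`), lower `u` by `tψ(1 - H(u - φ))`, where `H` is a
smooth bump of height one and width `ε` around `0`. This gives `∫ ∇u·∇ψ ≤ ∫ ∇φ·∇(Hψ) + ∫ ∇(u -
φ)·∇(Hψ)`: the first term is at most `nL ∫ ψ`, and the second is `O(ε)` after a term of good sign is
dropped.

The rest is potential theory. The radius derivative of a suitable radial averaging kernel is the
Laplacian of a nonnegative bump (`RadialKernel.hasDerivAt_kernel`), so averages of `u` decrease in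
the radius, by at most a multiple of `r²`. Their limit as `r → 0` is a continuous representative `v
≥ φ`, and averages over balls that avoid the contact set `{v = φ}` are equal to `v`.

At a contact point `x`, `v` differs from the tangent plane of `φ` by at most `A|y - x|²`
(`RadialKernel.exists_abs_sub_tangent_le`): from below because `v ≥ φ`, from above by a Harnack-type
comparison of averages at `x` and at `y`. At a point at distance `d` from its nearest contact point,
`v` minus the tangent plane there is harmonic and `O(d²)` at scale `d`, so interior estimates give a
quadratic expansion whose constant does not depend on `d` (`RadialKernel.exists_uniform_expansion`).
Locally uniform quadratic expansions at all points force `C^{1,1}_loc` (`isC11LocOn_of_expansion`).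
-/

namespace ObstacleProblem

/-! ### Convergence in `L²`, phrased for functions rather than classes. -/

section SquareIntegrable

variable {α G : Type*} [MeasurableSpace α] {μ : Measure α} [NormedAddCommGroup G]

/-- `F k → F₀` in `L²(μ)`. -/
def ConvL2 (μ : Measure α) (F : ℕ → α → G) (F₀ : α → G) : Prop :=
  Tendsto (fun k => eLpNorm (fun x => F k x - F₀ x) 2 μ) atTop (𝓝 0)

theorem ConvL2.const (F₀ : α → G) : ConvL2 μ (fun _ => F₀) F₀ := by
  simp [ConvL2]

theorem ConvL2.comp {F : ℕ → α → G} {F₀ : α → G} (h : ConvL2 μ F F₀) {ns : ℕ → ℕ}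
    (hns : StrictMono ns) : ConvL2 μ (fun k => F (ns k)) F₀ :=
  (show Tendsto (fun k => eLpNorm (fun x => F k x - F₀ x) 2 μ) atTop (𝓝 0) from h).comp
    hns.tendsto_atTop

theorem ConvL2.add {F F' : ℕ → α → G} {F₀ F₀' : α → G} (h : ConvL2 μ F F₀) (h' : ConvL2 μ F' F₀')
    (hm : ∀ k, AEStronglyMeasurable (F k) μ) (hm₀ : AEStronglyMeasurable F₀ μ)
    (hm' : ∀ k, AEStronglyMeasurable (F' k) μ) (hm₀' : AEStronglyMeasurable F₀' μ) :
    ConvL2 μ (fun k x => F k x + F' k x) (fun x => F₀ x + F₀' x) := by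
  have hs := Tendsto.add h h'
  rw [add_zero] at hs
  refine tendsto_of_tendsto_of_tendsto_of_le_of_le tendsto_const_nhds hs (fun k => zero_le) ?_
  intro k
  have := eLpNorm_add_le (μ := μ) (p := 2) ((hm k).sub hm₀) ((hm' k).sub hm₀') (by norm_num)
  refine le_trans (le_of_eq (congrArg (fun f => eLpNorm f 2 μ) ?_)) this
  ext x
  simp only [Pi.add_apply, Pi.sub_apply]
  abel

theorem ConvL2.const_smul [NormedSpace ℝ G] {F : ℕ → α → G} {F₀ : α → G} (h : ConvL2 μ F F₀)
    (c : ℝ) : ConvL2 μ (fun k x => c • F k x) (fun x => c • F₀ x) := by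
  have hs := ENNReal.Tendsto.const_mul (a := ‖c‖ₑ) h (Or.inr (by simp))
  rw [mul_zero] at hs
  refine hs.congr fun k => ?_
  rw [← eLpNorm_const_smul]
  congr 1
  ext x
  simp [smul_sub]

theorem ConvL2.memLp {F : ℕ → α → G} {F₀ : α → G} (h : ConvL2 μ F F₀)
    (hF : ∀ k, MemLp (F k) 2 μ) (hm₀ : AEStronglyMeasurable F₀ μ) : MemLp F₀ 2 μ := by
  obtain ⟨k, hk⟩ := (h.eventually (gt_mem_nhds (ENNReal.zero_lt_top))).exists
  have h1 : MemLp (fun x => F k x - F₀ x) 2 μ := ⟨(hF k).1.sub hm₀, hk⟩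
  have := (hF k).sub h1
  convert this using 1
  ext x
  simp

theorem ConvL2.exists_subseq_ae {F : ℕ → α → G} {F₀ : α → G} (h : ConvL2 μ F F₀)
    (hF : ∀ k, AEStronglyMeasurable (F k) μ) (hm₀ : AEStronglyMeasurable F₀ μ) :
    ∃ ns : ℕ → ℕ, StrictMono ns ∧ ∀ᵐ x ∂μ, Tendsto (fun k => F (ns k) x) atTop (𝓝 (F₀ x)) :=
  (tendstoInMeasure_of_tendsto_eLpNorm (by norm_num) hF hm₀ h).exists_seq_tendsto_ae

theorem ConvL2.tendsto_integral_inner [InnerProductSpace ℝ G]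
    {F F' : ℕ → α → G} {F₀ F₀' : α → G} (h : ConvL2 μ F F₀) (h' : ConvL2 μ F' F₀')
    (hF : ∀ k, MemLp (F k) 2 μ) (hF₀ : MemLp F₀ 2 μ)
    (hF' : ∀ k, MemLp (F' k) 2 μ) (hF₀' : MemLp F₀' 2 μ) :
    Tendsto (fun k => ∫ x, inner ℝ (F k x) (F' k x) ∂μ) atTop
      (𝓝 (∫ x, inner ℝ (F₀ x) (F₀' x) ∂μ)) := by
  have key : ∀ {f g : α → G} (hf : MemLp f 2 μ) (hg : MemLp g 2 μ),
      ∫ x, inner ℝ (f x) (g x) ∂μ = inner ℝ (hf.toLp f) (hg.toLp g) := by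
    intro f g hf hg
    rw [L2.inner_def]
    refine integral_congr_ae ?_
    filter_upwards [hf.coeFn_toLp, hg.coeFn_toLp] with x hx hy
    rw [hx, hy]
  rw [key hF₀ hF₀']
  simp_rw [fun k => key (hF k) (hF' k)]
  exact Tendsto.inner ((Lp.tendsto_Lp_iff_tendsto_eLpNorm'' _ hF _ hF₀).2 h)
    ((Lp.tendsto_Lp_iff_tendsto_eLpNorm'' _ hF' _ hF₀').2 h')

/-- Split `a_k F_k - a₀ F₀ = a_k (F_k - F₀) + (a_k - a₀) F₀`: the first term is controlled by the
uniform bound, the second by dominated convergence. It passes to the limit in chain-rule gradients,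
whose coefficients converge only almost everywhere. -/
theorem ConvL2.smul_of_bounded [NormedSpace ℝ G] {F : ℕ → α → G} {F₀ : α → G}
    (h : ConvL2 μ F F₀) (hF : ∀ k, AEStronglyMeasurable (F k) μ) (hF₀ : MemLp F₀ 2 μ)
    {a : ℕ → α → ℝ} {a₀ : α → ℝ} {C : ℝ} (hC : ∀ k x, |a k x| ≤ C)
    (ha : ∀ k, AEStronglyMeasurable (a k) μ) (ha₀ : AEStronglyMeasurable a₀ μ)
    (hlim : ∀ᵐ x ∂μ, Tendsto (fun k => a k x) atTop (𝓝 (a₀ x))) :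
    ConvL2 μ (fun k x => a k x • F k x) (fun x => a₀ x • F₀ x) := by
  have h1 : Tendsto (fun k => eLpNorm (fun x => a k x • (F k x - F₀ x)) 2 μ) atTop (𝓝 0) := by
    have hs := ENNReal.Tendsto.const_mul (a := ENNReal.ofReal C) h (Or.inr (by simp))
    rw [mul_zero] at hs
    refine tendsto_of_tendsto_of_tendsto_of_le_of_le tendsto_const_nhds hs (fun k => zero_le) ?_
    intro k
    refine eLpNorm_le_mul_eLpNorm_of_ae_le_mul (.of_forall fun x => ?_) 2
    rw [norm_smul]
    exact mul_le_mul_of_nonneg_right (hC k x) (norm_nonneg _)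
  have h2 : Tendsto (fun k => eLpNorm (fun x => (a k x - a₀ x) • F₀ x) 2 μ) atTop (𝓝 0) := by
    have h3 : Tendsto (fun k => ∫⁻ x, ‖(a k x - a₀ x) • F₀ x‖ₑ ^ (2:ℝ) ∂μ) atTop
        (𝓝 (∫⁻ _, 0 ∂μ)) := by
      refine tendsto_lintegral_of_dominated_convergence'
        (fun x => (ENNReal.ofReal (2 * C)) ^ (2:ℝ) * ‖F₀ x‖ₑ ^ (2:ℝ)) ?_ ?_ ?_ ?_
      · intro k
        exact ((((ha k).sub ha₀).smul hF₀.1).enorm).pow_const _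
      · intro k
        filter_upwards [hlim] with x hx
        have hx0 : |a₀ x| ≤ C :=
          le_of_tendsto (hx.abs) (.of_forall fun k => hC k x)
        rw [← ENNReal.mul_rpow_of_nonneg _ _ (by norm_num : (0:ℝ) ≤ 2)]
        refine ENNReal.rpow_le_rpow ?_ (by norm_num)
        rw [enorm_smul]
        refine mul_le_mul_left ?_ _
        rw [Real.enorm_eq_ofReal_abs]
        refine ENNReal.ofReal_le_ofReal ?_
        calc |a k x - a₀ x| ≤ |a k x| + |a₀ x| := abs_sub _ _
          _ ≤ 2 * C := by linarith [hC k x]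
      · rw [lintegral_const_mul' _ _ (ENNReal.rpow_ne_top_of_nonneg (by norm_num) ENNReal.ofReal_ne_top)]
        refine ENNReal.mul_ne_top (ENNReal.rpow_ne_top_of_nonneg (by norm_num) ENNReal.ofReal_ne_top) ?_
        have := lintegral_rpow_enorm_lt_top_of_eLpNorm_lt_top (by norm_num) (by norm_num) hF₀.2
        simpa using this.ne
      · filter_upwards [hlim] with x hx
        have h4 : Tendsto (fun k => (a k x - a₀ x) • F₀ x) atTop (𝓝 0) := by
          have := (hx.sub_const (a₀ x)).smul_const (F₀ x)
          simpa using this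
        have h5 := (ENNReal.continuous_rpow_const (y := (2:ℝ))).tendsto _ |>.comp h4.enorm
        refine Tendsto.congr (fun k => rfl) (h5.trans (le_of_eq ?_))
        simp
    rw [lintegral_zero] at h3
    have h6 := (ENNReal.continuous_rpow_const (y := (1/2:ℝ))).tendsto _ |>.comp h3
    rw [ENNReal.zero_rpow_of_pos (by norm_num)] at h6
    refine h6.congr fun k => ?_
    rw [eLpNorm_eq_lintegral_rpow_enorm_toReal (by norm_num) (by norm_num)]
    simp
  have hs := h1.add h2
  rw [add_zero] at hs
  refine tendsto_of_tendsto_of_tendsto_of_le_of_le tendsto_const_nhds hs (fun k => zero_le) ?_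
  intro k
  have := eLpNorm_add_le (μ := μ) (p := 2) ((ha k).smul ((hF k).sub hF₀.1))
    (((ha k).sub ha₀).smul hF₀.1) (by norm_num)
  refine le_trans (le_of_eq (congrArg (fun f => eLpNorm f 2 μ) ?_)) this
  ext x
  simp only [Pi.add_apply, Pi.sub_apply, Pi.smul_apply', smul_sub, sub_smul]
  abel

end SquareIntegrable

/-! ### First variation of the Dirichlet integral. -/

section Variation

variable {n : ℕ} {Ω : Set (EuclideanSpace ℝ (Fin n))}

theorem memLp_restrict_of_continuous {G : Type*} [NormedAddCommGroup G] [SecondCountableTopology G]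
    (hΩb : Bornology.IsBounded Ω)
    (hΩ : MeasurableSet Ω) {V : EuclideanSpace ℝ (Fin n) → G} (hV : Continuous V) :
    MemLp V 2 (volume.restrict Ω) := by
  have hc : IsCompact (closure Ω) := hΩb.isCompact_closure
  obtain ⟨C, hC⟩ := hc.exists_bound_of_continuousOn hV.continuousOn
  have : IsFiniteMeasure (volume.restrict Ω) :=
    isFiniteMeasure_restrict.2 hΩb.measure_lt_top.ne
  exact MemLp.of_bound hV.aestronglyMeasurable C
    (ae_restrict_of_forall_mem hΩ fun x hx => hC x (subset_closure hx))

theorem continuous_gradient {V : EuclideanSpace ℝ (Fin n) → ℝ} (hV : ContDiff ℝ 1 V) :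
    Continuous (gradient V) :=
  (InnerProductSpace.toDual ℝ _).symm.continuous.comp (hV.continuous_fderiv one_ne_zero)

theorem gradient_eq_zero_of_notMem_tsupport {V : EuclideanSpace ℝ (Fin n) → ℝ}
    {x : EuclideanSpace ℝ (Fin n)} (hx : x ∉ tsupport V) : gradient V x = 0 := by
  rw [gradient, image_eq_zero_of_notMem_tsupport fun h => hx (tsupport_fderiv_subset ℝ h)]
  simp

theorem integral_mul_fderiv_eq_neg {V ψ : EuclideanSpace ℝ (Fin n) → ℝ} (hV : ContDiff ℝ 1 V)
    (hψ : ContDiff ℝ 1 ψ) (hc : HasCompactSupport ψ) (e : EuclideanSpace ℝ (Fin n)) :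
    ∫ x, V x * fderiv ℝ ψ x e = - ∫ x, fderiv ℝ V x e * ψ x := by
  have hcV : Continuous fun x => fderiv ℝ V x e :=
    (hV.continuous_fderiv one_ne_zero).clm_apply continuous_const
  have hcψ : Continuous fun x => fderiv ℝ ψ x e :=
    (hψ.continuous_fderiv one_ne_zero).clm_apply continuous_const
  refine integral_mul_fderiv_eq_neg_fderiv_mul_of_integrable ?_ ?_ ?_ ?_ ?_
  · exact (hcV.mul hψ.continuous).integrable_of_hasCompactSupport hc.mul_left
  · exact (hV.continuous.mul hcψ).integrable_of_hasCompactSupport (hc.fderiv_apply ℝ e).mul_left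
  · exact (hV.continuous.mul hψ.continuous).integrable_of_hasCompactSupport hc.mul_left
  · exact fun x _ => (hV.differentiable one_ne_zero) x
  · exact fun x _ => (hψ.differentiable one_ne_zero) x

/-- Integration by parts holds for each `C¹` approximant, and both sides are `L²` pairings, hence
pass to the limit. This is how perturbed functions are certified to lie in `W^{1,2}(Ω)`. -/
theorem isWeakGradient_of_convL2 (hΩo : IsOpen Ω) (hΩb : Bornology.IsBounded Ω)
    {V : ℕ → EuclideanSpace ℝ (Fin n) → ℝ} (hV : ∀ k, ContDiff ℝ 1 (V k))
    {w : EuclideanSpace ℝ (Fin n) → ℝ} {g : EuclideanSpace ℝ (Fin n) → EuclideanSpace ℝ (Fin n)}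
    (hw : MemLp w 2 (volume.restrict Ω)) (hg : MemLp g 2 (volume.restrict Ω))
    (h : ConvL2 (volume.restrict Ω) V w)
    (h' : ConvL2 (volume.restrict Ω) (fun k => gradient (V k)) g) : IsWeakGradient Ω w g := by
  intro ψ hψ hc hs e
  have hψ1 : ContDiff ℝ 1 ψ := hψ.of_le (by simp)
  have hcψ : Continuous fun x => fderiv ℝ ψ x e :=
    (hψ1.continuous_fderiv one_ne_zero).clm_apply continuous_const
  have m := hΩo.measurableSet
  have m1 := memLp_restrict_of_continuous hΩb m hcψ
  have m2 : MemLp (fun x => ψ x • e) 2 (volume.restrict Ω) :=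
    memLp_restrict_of_continuous hΩb m (hψ1.continuous.smul continuous_const)
  have mV := fun k => memLp_restrict_of_continuous hΩb m (hV k).continuous
  have mG := fun k => memLp_restrict_of_continuous hΩb m (continuous_gradient (hV k))
  have l1 := (h.tendsto_integral_inner (ConvL2.const _) mV hw (fun _ => m1) m1)
  have l2 := (h'.tendsto_integral_inner (ConvL2.const _) mG hg (fun _ => m2) m2).neg
  have e1 : ∫ x in Ω, w x * fderiv ℝ ψ x e = ∫ x in Ω, inner ℝ (w x) (fderiv ℝ ψ x e) := by
    simp [mul_comm]
  have e2 : ∫ x in Ω, inner ℝ (g x) e * ψ x = ∫ x in Ω, inner ℝ (g x) (ψ x • e) := by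
    simp [inner_smul_right, mul_comm]
  rw [e1, e2]
  refine tendsto_nhds_unique l1 (l2.congr fun k => ?_)
  have z1 : ∀ x, x ∉ Ω → inner ℝ (V k x) (fderiv ℝ ψ x e) = 0 := by
    intro x hx
    rw [image_eq_zero_of_notMem_tsupport fun h => hx (hs (tsupport_fderiv_subset ℝ h))]
    simp
  have z2 : ∀ x, x ∉ Ω → inner ℝ (gradient (V k) x) (ψ x • e) = 0 := by
    intro x hx
    rw [image_eq_zero_of_notMem_tsupport fun h => hx (hs h)]
    simp
  rw [setIntegral_eq_integral_of_forall_compl_eq_zero z1,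
    setIntegral_eq_integral_of_forall_compl_eq_zero z2]
  have := integral_mul_fderiv_eq_neg (hV k) hψ1 hc e
  simp only [inner_smul_right, inner_gradient_left]
  simp only [RCLike.inner_apply, conj_trivial]
  simp_rw [mul_comm (fderiv ℝ ψ _ e), mul_comm (ψ _)]
  exact this.symm

/-- `C¹` functions `W k` converge to `u` in `W^{1,2}(Ω)` and to `f` on the boundary. -/
structure Approximates (Ω : Set (EuclideanSpace ℝ (Fin n))) (f u : EuclideanSpace ℝ (Fin n) → ℝ)
    (g : EuclideanSpace ℝ (Fin n) → EuclideanSpace ℝ (Fin n))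
    (W : ℕ → EuclideanSpace ℝ (Fin n) → ℝ) : Prop where
  contDiff : ∀ k, ContDiff ℝ 1 (W k)
  conv : ConvL2 (volume.restrict Ω) W u
  conv_gradient : ConvL2 (volume.restrict Ω) (fun k => gradient (W k)) g
  conv_boundary : ConvL2 ((Measure.hausdorffMeasure ((n : ℝ) - 1)).restrict (frontier Ω)) W f

theorem HasTrace.exists_approximates {u f : EuclideanSpace ℝ (Fin n) → ℝ}
    {g : EuclideanSpace ℝ (Fin n) → EuclideanSpace ℝ (Fin n)} (h : HasTrace Ω u g f) :
    ∃ W, Approximates Ω f u g W := by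
  obtain ⟨W, h0, h1, h2, h3⟩ := h
  exact ⟨W, h0, h1, h2, h3⟩

theorem integrable_inner_of_memLp {α G : Type*} [MeasurableSpace α] {μ : Measure α}
    [NormedAddCommGroup G] [InnerProductSpace ℝ G] {f g : α → G} (hf : MemLp f 2 μ)
    (hg : MemLp g 2 μ) : Integrable (fun x => inner ℝ (f x) (g x)) μ := by
  refine (L2.integrable_inner (𝕜 := ℝ) (hf.toLp f) (hg.toLp g)).congr ?_
  filter_upwards [hf.coeFn_toLp, hg.coeFn_toLp] with x hx hy
  rw [hx, hy]

/-- A minimizer satisfies the variational inequality in every direction that keeps it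
above the obstacle. -/
theorem integral_inner_nonneg_of_isMinimizer (hΩo : IsOpen Ω) (hΩb : Bornology.IsBounded Ω)
    {φ f u : EuclideanSpace ℝ (Fin n) → ℝ}
    {gu : EuclideanSpace ℝ (Fin n) → EuclideanSpace ℝ (Fin n)}
    (hadm : IsAdmissible Ω φ f u gu)
    (hmin : ∀ w gw, IsAdmissible Ω φ f w gw →
      ∫ x in Ω, ‖gu x‖ ^ 2 / 2 ≤ ∫ x in Ω, ‖gw x‖ ^ 2 / 2)
    {W : ℕ → EuclideanSpace ℝ (Fin n) → ℝ} (hW : Approximates Ω f u gu W)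
    {Z : ℕ → EuclideanSpace ℝ (Fin n) → ℝ} (hZ : ∀ k, ContDiff ℝ 1 (Z k))
    (hZ0 : ∀ k, ∀ x ∈ frontier Ω, Z k x = 0) {ζ : EuclideanSpace ℝ (Fin n) → ℝ}
    {gζ : EuclideanSpace ℝ (Fin n) → EuclideanSpace ℝ (Fin n)}
    (mζ : AEStronglyMeasurable ζ (volume.restrict Ω))
    (mgζ : AEStronglyMeasurable gζ (volume.restrict Ω))
    (c1 : ConvL2 (volume.restrict Ω) Z ζ)
    (c2 : ConvL2 (volume.restrict Ω) (fun k => gradient (Z k)) gζ)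
    {t₀ : ℝ} (ht₀ : 0 < t₀)
    (hobs : ∀ t, 0 < t → t ≤ t₀ → ∀ᵐ x ∂(volume.restrict Ω), φ x ≤ u x + t * ζ x) :
    0 ≤ ∫ x in Ω, inner ℝ (gu x) (gζ x) := by
  have m := hΩo.measurableSet
  have mZ := fun k => memLp_restrict_of_continuous hΩb m (hZ k).continuous
  have mGZ := fun k => memLp_restrict_of_continuous hΩb m (continuous_gradient (hZ k))
  have mW := fun k => memLp_restrict_of_continuous hΩb m (hW.contDiff k).continuous
  have mGW := fun k => memLp_restrict_of_continuous hΩb m (continuous_gradient (hW.contDiff k))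
  have Lζ := c1.memLp mZ mζ
  have Lgζ := c2.memLp mGZ mgζ
  have Lu := hadm.isW12.memLp
  have Lgu := hadm.isW12.memLp_grad
  -- Minimality against `u + tζ`: expand the square and divide by `t`. Letting `t → 0` afterwards
  -- removes the quadratic term.
  have hineq : ∀ t, 0 < t → t ≤ t₀ →
      0 ≤ (∫ x in Ω, inner ℝ (gu x) (gζ x)) + t * ∫ x in Ω, ‖gζ x‖ ^ 2 / 2 := by
    intro t ht htt
    have cV : ConvL2 (volume.restrict Ω) (fun k x => W k x + t • Z k x)
        (fun x => u x + t • ζ x) :=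
      hW.conv.add (c1.const_smul t) (fun k => (mW k).1) Lu.1 (fun k => (mZ k).1.const_smul t)
        (mζ.const_smul t)
    have hVC : ∀ k, ContDiff ℝ 1 (fun x => W k x + t • Z k x) := fun k =>
      (hW.contDiff k).add ((hZ k).const_smul t)
    have hgV : ∀ k, gradient (fun x => W k x + t • Z k x) =
        fun x => gradient (W k) x + t • gradient (Z k) x := by
      intro k
      ext1 x
      have d1 := (hW.contDiff k).differentiable one_ne_zero x
      have d2 := (hZ k).differentiable one_ne_zero x
      simp only [gradient]
      have h2 : HasFDerivAt (fun x => W k x + t • Z k x)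
          (fderiv ℝ (W k) x + t • fderiv ℝ (Z k) x) x :=
        d1.hasFDerivAt.add (d2.hasFDerivAt.const_smul t)
      rw [h2.fderiv]
      simp
    have cGV : ConvL2 (volume.restrict Ω) (fun k => gradient (fun x => W k x + t • Z k x))
        (fun x => gu x + t • gζ x) := by
      simp_rw [hgV]
      exact hW.conv_gradient.add (c2.const_smul t) (fun k => (mGW k).1) Lgu.1
        (fun k => (mGZ k).1.const_smul t) (mgζ.const_smul t)
    have Lw : MemLp (fun x => u x + t • ζ x) 2 (volume.restrict Ω) := Lu.add (Lζ.const_smul t)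
    have Lgw : MemLp (fun x => gu x + t • gζ x) 2 (volume.restrict Ω) :=
      Lgu.add (Lgζ.const_smul t)
    have hle := hmin (fun x => u x + t • ζ x) (fun x => gu x + t • gζ x)
      ⟨⟨Lw, Lgw, isWeakGradient_of_convL2 hΩo hΩb hVC Lw Lgw cV cGV⟩,
        ⟨_, hVC, cV, cGV, ?_⟩, by simpa using hobs t ht htt⟩
    · have i1 : Integrable (fun x => ‖gu x‖ ^ 2 / 2) (volume.restrict Ω) :=
        (Lgu.integrable_norm_pow (by norm_num)).div_const 2
      have i2 : Integrable (fun x => inner ℝ (gu x) (gζ x)) (volume.restrict Ω) :=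
        integrable_inner_of_memLp Lgu Lgζ
      have i3 : Integrable (fun x => ‖gζ x‖ ^ 2 / 2) (volume.restrict Ω) :=
        (Lgζ.integrable_norm_pow (by norm_num)).div_const 2
      have : ∀ x, ‖gu x + t • gζ x‖ ^ 2 / 2 =
          ‖gu x‖ ^ 2 / 2 + (t * inner ℝ (gu x) (gζ x) + t ^ 2 * (‖gζ x‖ ^ 2 / 2)) := by
        intro x
        rw [norm_add_sq_real, inner_smul_right, norm_smul, mul_pow, Real.norm_eq_abs, sq_abs]
        ring
      simp_rw [this] at hle
      have i4 : Integrable (fun x => t * inner ℝ (gu x) (gζ x) + t ^ 2 * (‖gζ x‖ ^ 2 / 2))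
          (volume.restrict Ω) := (i2.const_mul t).add (i3.const_mul (t ^ 2))
      rw [integral_add i1 i4, integral_add (i2.const_mul t) (i3.const_mul (t ^ 2)), integral_const_mul,
        integral_const_mul] at hle
      have h0 : 0 ≤ t * ((∫ x in Ω, inner ℝ (gu x) (gζ x)) + t * ∫ x in Ω, ‖gζ x‖ ^ 2 / 2) := by
        nlinarith
      exact nonneg_of_mul_nonneg_right h0 ht
    -- The trace is unchanged, since the approximants `Z k` vanish on the boundary.
    · refine Tendsto.congr (fun k => ?_) hW.conv_boundary
      refine eLpNorm_congr_ae ?_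
      refine ae_restrict_of_forall_mem isClosed_frontier.measurableSet fun x hx => ?_
      simp [hZ0 k x hx]
  have hlim : Tendsto (fun t : ℝ => (∫ x in Ω, inner ℝ (gu x) (gζ x)) +
      t * ∫ x in Ω, ‖gζ x‖ ^ 2 / 2) (𝓝[>] 0) (𝓝 (∫ x in Ω, inner ℝ (gu x) (gζ x))) := by
    have : Continuous fun t : ℝ => (∫ x in Ω, inner ℝ (gu x) (gζ x)) +
      t * ∫ x in Ω, ‖gζ x‖ ^ 2 / 2 := by fun_prop
    simpa using (this.tendsto 0).mono_left nhdsWithin_le_nhds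
  refine ge_of_tendsto hlim ?_
  filter_upwards [Ioc_mem_nhdsGT ht₀] with t ht using hineq t ht.1 ht.2

end Variation

/-! ### Weak Laplacians, and the bound inherited from a Lipschitz gradient. -/

section WeakBounds

variable {n : ℕ} {Ω : Set (EuclideanSpace ℝ (Fin n))}

/-- The Laplacian of `ψ`, in coordinates. -/
noncomputable def lap (ψ : EuclideanSpace ℝ (Fin n) → ℝ) (x : EuclideanSpace ℝ (Fin n)) : ℝ :=
  ∑ i, fderiv ℝ (fun y => fderiv ℝ ψ y (EuclideanSpace.single i 1)) x (EuclideanSpace.single i 1)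

theorem inner_gradient_eq_sum (v : EuclideanSpace ℝ (Fin n)) (ψ : EuclideanSpace ℝ (Fin n) → ℝ)
    (x : EuclideanSpace ℝ (Fin n)) : inner ℝ v (gradient ψ x) =
      ∑ i, inner ℝ v (EuclideanSpace.single i 1) * fderiv ℝ ψ x (EuclideanSpace.single i 1) := by
  simp_rw [← inner_gradient_left, EuclideanSpace.inner_single_right, PiLp.inner_apply]
  simp [mul_comm]

theorem contDiff_fderiv_apply {ψ : EuclideanSpace ℝ (Fin n) → ℝ} (hψ : ContDiff ℝ ∞ ψ)
    (e : EuclideanSpace ℝ (Fin n)) : ContDiff ℝ ∞ fun y => fderiv ℝ ψ y e :=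
  (hψ.fderiv_right (m := ∞) (by simp)).clm_apply contDiff_const

theorem continuous_lap {ψ : EuclideanSpace ℝ (Fin n) → ℝ} (hψ : ContDiff ℝ ∞ ψ) :
    Continuous (lap ψ) :=
  continuous_finsetSum _ fun _ _ =>
    (contDiff_fderiv_apply (contDiff_fderiv_apply hψ _) _).continuous

theorem tsupport_fderiv_apply_subset (ψ : EuclideanSpace ℝ (Fin n) → ℝ)
    (e : EuclideanSpace ℝ (Fin n)) : tsupport (fun y => fderiv ℝ ψ y e) ⊆ tsupport ψ := by
  refine closure_minimal (fun x hx => ?_) (isClosed_tsupport _)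
  by_contra h
  exact hx (by simp [image_eq_zero_of_notMem_tsupport fun h' => h (tsupport_fderiv_subset ℝ h')])

theorem lap_eq_zero_of_notMem_tsupport {ψ : EuclideanSpace ℝ (Fin n) → ℝ}
    {x : EuclideanSpace ℝ (Fin n)} (hx : x ∉ tsupport ψ) : lap ψ x = 0 := by
  refine Finset.sum_eq_zero fun i _ => ?_
  rw [image_eq_zero_of_notMem_tsupport fun h =>
    hx (tsupport_fderiv_apply_subset ψ _ (tsupport_fderiv_subset ℝ h))]
  simp

/-- Test the weak gradient with `∂_i ψ` in the direction `e_i` and sum over `i`. -/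
theorem IsWeakGradient.integral_inner_gradient {w : EuclideanSpace ℝ (Fin n) → ℝ}
    {g : EuclideanSpace ℝ (Fin n) → EuclideanSpace ℝ (Fin n)} (h : IsWeakGradient Ω w g)
    (hΩo : IsOpen Ω) (hΩb : Bornology.IsBounded Ω)
    (hw : MemLp w 2 (volume.restrict Ω)) (hg : MemLp g 2 (volume.restrict Ω))
    {ψ : EuclideanSpace ℝ (Fin n) → ℝ} (hψ : ContDiff ℝ ∞ ψ) (hc : HasCompactSupport ψ)
    (hs : tsupport ψ ⊆ Ω) :
    ∫ x in Ω, inner ℝ (g x) (gradient ψ x) = - ∫ x in Ω, w x * lap ψ x := by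
  have m := hΩo.measurableSet
  simp_rw [inner_gradient_eq_sum, lap, Finset.mul_sum]
  rw [integral_finsetSum, integral_finsetSum, ← Finset.sum_neg_distrib]
  · refine Finset.sum_congr rfl fun i _ => ?_
    rw [h _ (contDiff_fderiv_apply hψ _) (hc.fderiv_apply ℝ _)
      ((tsupport_fderiv_apply_subset ψ _).trans hs), neg_neg]
  · intro i _
    exact hw.integrable_mul (memLp_restrict_of_continuous hΩb m
      (contDiff_fderiv_apply (contDiff_fderiv_apply hψ _) _).continuous)
  · intro i _
    exact (hg.inner_const (𝕜 := ℝ) _).integrable_mul (memLp_restrict_of_continuous hΩb m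
      (contDiff_fderiv_apply hψ _).continuous)

theorem integral_inner_gradient_eq {V ψ : EuclideanSpace ℝ (Fin n) → ℝ} (hV : ContDiff ℝ 1 V)
    (hψ : ContDiff ℝ ∞ ψ) (hc : HasCompactSupport ψ) :
    ∫ x, inner ℝ (gradient V x) (gradient ψ x) = - ∫ x, V x * lap ψ x := by
  simp_rw [inner_gradient_eq_sum, lap, Finset.mul_sum, inner_gradient_left]
  rw [integral_finsetSum, integral_finsetSum, ← Finset.sum_neg_distrib]
  · refine Finset.sum_congr rfl fun i _ => ?_
    rw [integral_mul_fderiv_eq_neg hV ((contDiff_fderiv_apply hψ _).of_le (by simp))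
      (hc.fderiv_apply ℝ _), neg_neg]
  · intro i _
    exact (hV.continuous.mul (contDiff_fderiv_apply (contDiff_fderiv_apply hψ _) _).continuous
      ).integrable_of_hasCompactSupport ((hc.fderiv_apply ℝ _).fderiv_apply ℝ _).mul_left
  · intro i _
    exact (((hV.continuous_fderiv one_ne_zero).clm_apply continuous_const).mul
      (contDiff_fderiv_apply hψ _).continuous
      ).integrable_of_hasCompactSupport (hc.fderiv_apply ℝ _).mul_left

/-- A function with Lipschitz gradient has Laplacian bounded from below, weakly. -/
theorem integral_inner_gradient_le_of_lipschitz {φ ζ : EuclideanSpace ℝ (Fin n) → ℝ} {C : ℝ≥0}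
    (hφ : LipschitzOnWith C (fderiv ℝ φ) Ω) (hζ : ContDiff ℝ 1 ζ) (hc : HasCompactSupport ζ)
    (hs : tsupport ζ ⊆ Ω) (h0 : ∀ x, 0 ≤ ζ x) :
    ∫ x, inner ℝ (gradient φ x) (gradient ζ x) ≤ n * C * ∫ x, ζ x := by
  -- Each partial derivative of `φ` is extended to a globally Lipschitz function, so that
  -- integration by parts for Lipschitz functions applies on the whole space.
  have hext : ∀ i : Fin n, ∃ p : EuclideanSpace ℝ (Fin n) → ℝ, LipschitzWith C p ∧
      Set.EqOn (fun x => fderiv ℝ φ x (EuclideanSpace.single i 1)) p Ω := by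
    intro i
    refine LipschitzOnWith.extend_real (LipschitzOnWith.of_dist_le_mul fun x hx y hy => ?_)
    have := hφ.dist_le_mul x hx y hy
    rw [dist_eq_norm] at this ⊢
    rw [← sub_apply]
    refine (ContinuousLinearMap.le_opNorm _ _).trans ?_
    simpa using this
  choose p hp hpe using hext
  have hcζ : ∀ i : Fin n, Continuous fun x => fderiv ℝ ζ x (EuclideanSpace.single i 1) := fun i =>
    (hζ.continuous_fderiv one_ne_zero).clm_apply continuous_const
  have hiζ : Integrable ζ := hζ.continuous.integrable_of_hasCompactSupport hc
  have e1 : ∀ x, inner ℝ (gradient φ x) (gradient ζ x) =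
      ∑ i, p i x * fderiv ℝ ζ x (EuclideanSpace.single i 1) := by
    intro x
    rw [inner_gradient_eq_sum]
    refine Finset.sum_congr rfl fun i _ => ?_
    rw [inner_gradient_left]
    by_cases hx : x ∈ Ω
    · rw [show fderiv ℝ φ x (EuclideanSpace.single i 1) = p i x from hpe i hx]
    · rw [image_eq_zero_of_notMem_tsupport fun h => hx (hs (tsupport_fderiv_subset ℝ h))]
      simp
  simp_rw [e1]
  rw [integral_finsetSum]
  · have : (n * C * ∫ x, ζ x) = ∑ _i : Fin n, C * ∫ x, ζ x := by simp [mul_assoc]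
    rw [this]
    refine Finset.sum_le_sum fun i _ => ?_
    obtain ⟨D, hD⟩ := hζ.lipschitzWith_of_hasCompactSupport hc one_ne_zero
    have ibp := (hp i).integral_lineDeriv_mul_eq (μ := volume) hD hc (EuclideanSpace.single i 1)
    have e2 : ∀ x, lineDeriv ℝ ζ x (-(EuclideanSpace.single i 1)) =
        - fderiv ℝ ζ x (EuclideanSpace.single i 1) := by
      intro x
      rw [((hζ.differentiable one_ne_zero) x).lineDeriv_eq_fderiv, map_neg]
    simp_rw [e2, neg_mul] at ibp
    rw [integral_neg] at ibp
    have e3 : ∫ x, p i x * fderiv ℝ ζ x (EuclideanSpace.single i 1) =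
        ∫ x, -(lineDeriv ℝ (p i) x (EuclideanSpace.single i 1) * ζ x) := by
      rw [integral_neg, ibp, neg_neg]
      simp_rw [mul_comm]
    rw [e3, ← integral_const_mul]
    have hb : ∀ x, ‖lineDeriv ℝ (p i) x (EuclideanSpace.single i 1)‖ ≤ C := by
      intro x
      simpa using norm_lineDeriv_le_of_lipschitz ℝ (hp i) (x₀ := x)
        (v := EuclideanSpace.single i (1 : ℝ))
    refine integral_mono (hiζ.bdd_mul (aestronglyMeasurable_lineDeriv (hp i).continuous volume)
      (.of_forall hb)).neg (hiζ.const_mul _) fun x => ?_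
    have := (abs_le.1 (hb x)).1
    nlinarith [h0 x]
  · intro i _
    exact ((hp i).continuous.mul (hcζ i)).integrable_of_hasCompactSupport
      (hc.fderiv_apply ℝ _).mul_left

end WeakBounds

/-! ### The Lewy–Stampacchia lower bound for the Laplacian. -/

section LewyStampacchia

variable {n : ℕ} {Ω : Set (EuclideanSpace ℝ (Fin n))}

/-- Multiply by a smooth cutoff equal to one near `K`. Approximating `u - φ` by globally `C¹`
functions requires a globally `C¹` obstacle, which only has to be correct near the support of the
test function. -/
theorem exists_contDiff_eqOn_nhds (hΩo : IsOpen Ω) {φ : EuclideanSpace ℝ (Fin n) → ℝ}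
    (hφ : ContDiffOn ℝ 1 φ Ω) {K : Set (EuclideanSpace ℝ (Fin n))} (hK : IsCompact K)
    (hKΩ : K ⊆ Ω) : ∃ (φ' : EuclideanSpace ℝ (Fin n) → ℝ) (O : Set (EuclideanSpace ℝ (Fin n))),
      ContDiff ℝ 1 φ' ∧ IsOpen O ∧ K ⊆ O ∧ O ⊆ Ω ∧ Set.EqOn φ' φ O := by
  obtain ⟨δ, hδ, hδΩ⟩ := hK.exists_cthickening_subset_open hΩo hKΩ
  have hd : Disjoint (Metric.thickening (δ / 2) K)ᶜ (Metric.cthickening (δ / 3) K) := by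
    rw [Set.disjoint_compl_left_iff_subset]
    exact Metric.cthickening_subset_thickening' (by positivity) (by linarith) _
  obtain ⟨χ, hχ, -, hχ0, hχ1⟩ := exists_contMDiff_zero_iff_one_iff_of_isClosed
    (n := ⊤) (modelWithCornersSelf ℝ (EuclideanSpace ℝ (Fin n)))
    (Metric.isOpen_thickening.isClosed_compl) Metric.isClosed_cthickening hd
  have hχd : ContDiff ℝ 1 χ := (contMDiff_iff_contDiff.1 hχ).of_le (by simp)
  have hsupp : tsupport χ ⊆ Ω := by
    refine (closure_minimal (fun x hx => ?_) Metric.isClosed_cthickening).trans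
      ((Metric.cthickening_mono (by linarith : δ / 2 ≤ δ) K).trans hδΩ)
    by_contra h
    exact hx ((hχ0 x).1 fun h' => h (Metric.thickening_subset_cthickening _ _ h'))
  refine ⟨fun x => χ x * φ x, Metric.thickening (δ / 3) K, ?_, Metric.isOpen_thickening,
    Metric.self_subset_thickening (by positivity) _, ?_, ?_⟩
  · refine contDiff_iff_contDiffAt.2 fun x => ?_
    by_cases hx : x ∈ Ω
    · exact hχd.contDiffAt.mul (hφ.contDiffAt (hΩo.mem_nhds hx))
    · have : (fun x => χ x * φ x) =ᶠ[𝓝 x] fun _ => 0 := by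
        have := notMem_tsupport_iff_eventuallyEq.1 fun h => hx (hsupp h)
        filter_upwards [this] with y hy
        simp [hy]
      exact contDiffAt_const.congr_of_eventuallyEq this
  · exact (Metric.thickening_subset_cthickening _ _).trans
      ((Metric.cthickening_mono (by linarith) K).trans hδΩ)
  · intro x hx
    simp [(hχ1 x).1 (Metric.thickening_subset_cthickening _ _ hx)]

/-- The profile equals one at `0`, decreases on `[0, ∞)`, and has the primitive `ε arctan(s/ε)`,
which is `O(ε)` uniformly. Being smooth, it can be composed with `C¹` approximants by the classical
chain rule. -/
theorem contDiff_bumpProfile {ε : ℝ} (hε : 0 < ε) {m : WithTop ℕ∞} :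
    ContDiff ℝ m fun s : ℝ => ε ^ 2 / (ε ^ 2 + s ^ 2) :=
  contDiff_const.div (contDiff_const.add (contDiff_id.pow 2)) fun s => by positivity

theorem hasDerivAt_bumpProfile {ε : ℝ} (hε : 0 < ε) (s : ℝ) :
    HasDerivAt (fun s : ℝ => ε ^ 2 / (ε ^ 2 + s ^ 2)) (-(2 * ε ^ 2 * s) / (ε ^ 2 + s ^ 2) ^ 2) s := by
  have h : HasDerivAt (fun s : ℝ => ε ^ 2 + s ^ 2) (2 * s) s := by
    simpa using ((hasDerivAt_id s).pow 2).const_add (ε ^ 2)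
  refine ((hasDerivAt_const s (ε ^ 2)).div h (by positivity)).congr_deriv ?_
  ring

theorem abs_deriv_bumpProfile_le {ε : ℝ} (hε : 0 < ε) (s : ℝ) :
    |-(2 * ε ^ 2 * s) / (ε ^ 2 + s ^ 2) ^ 2| ≤ 1 / ε := by
  rw [abs_div, abs_of_pos (by positivity : 0 < (ε ^ 2 + s ^ 2) ^ 2), abs_neg, abs_mul,
    abs_of_pos (by positivity : 0 < 2 * ε ^ 2), div_le_div_iff₀ (by positivity) hε]
  have h1 : 2 * ε * |s| ≤ ε ^ 2 + s ^ 2 := by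
    rw [← sq_abs s]; nlinarith [sq_nonneg (ε - |s|)]
  have h2 : ε ^ 2 ≤ ε ^ 2 + s ^ 2 := by nlinarith [sq_nonneg s]
  calc 2 * ε ^ 2 * |s| * ε = (2 * ε * |s|) * ε ^ 2 := by ring
    _ ≤ (ε ^ 2 + s ^ 2) * (ε ^ 2 + s ^ 2) := mul_le_mul h1 h2 (by positivity) (by positivity)
    _ = 1 * (ε ^ 2 + s ^ 2) ^ 2 := by ring

theorem hasDerivAt_mul_arctan {ε : ℝ} (hε : 0 < ε) (s : ℝ) :
    HasDerivAt (fun s : ℝ => ε * Real.arctan (s / ε)) (ε ^ 2 / (ε ^ 2 + s ^ 2)) s := by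
  refine ((((hasDerivAt_id s).div_const ε).arctan).const_mul ε).congr_deriv ?_
  simp only [id]
  field_simp

theorem abs_mul_arctan_le {ε : ℝ} (hε : 0 < ε) (s : ℝ) : |ε * Real.arctan (s / ε)| ≤ 2 * ε := by
  rw [abs_mul, abs_of_pos hε]
  have h1 := Real.arctan_lt_pi_div_two (s / ε)
  have h2 := Real.neg_pi_div_two_lt_arctan (s / ε)
  have : |Real.arctan (s / ε)| ≤ 2 := abs_le.2 ⟨by linarith [Real.pi_lt_four],
    by linarith [Real.pi_lt_four]⟩
  nlinarith

theorem gradient_comp_real {V : EuclideanSpace ℝ (Fin n) → ℝ} {x : EuclideanSpace ℝ (Fin n)}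
    (hV : DifferentiableAt ℝ V x) {θ : ℝ → ℝ} {θ' : ℝ} (hθ : HasDerivAt θ θ' (V x)) :
    gradient (fun y => θ (V y)) x = θ' • gradient V x := by
  have h := hθ.comp_hasFDerivAt x hV.hasFDerivAt
  have h' : HasFDerivAt (fun y => θ (V y)) (θ' • fderiv ℝ V x) x := h
  rw [gradient, gradient, h'.fderiv]
  simp

theorem gradient_sub_eq {V W : EuclideanSpace ℝ (Fin n) → ℝ} {x : EuclideanSpace ℝ (Fin n)}
    (hV : DifferentiableAt ℝ V x) (hW : DifferentiableAt ℝ W x) :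
    gradient (fun y => V y - W y) x = gradient V x - gradient W x := by
  have h : HasFDerivAt (fun y => V y - W y) (fderiv ℝ V x - fderiv ℝ W x) x :=
    hV.hasFDerivAt.sub hW.hasFDerivAt
  rw [gradient, gradient, gradient, h.fderiv]
  simp

theorem gradient_mul_eq {V W : EuclideanSpace ℝ (Fin n) → ℝ} {x : EuclideanSpace ℝ (Fin n)}
    (hV : DifferentiableAt ℝ V x) (hW : DifferentiableAt ℝ W x) :
    gradient (fun y => V y * W y) x = V x • gradient W x + W x • gradient V x := by
  have h : HasFDerivAt (fun y => V y * W y) (V x • fderiv ℝ W x + W x • fderiv ℝ V x) x :=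
    hV.hasFDerivAt.mul hW.hasFDerivAt
  rw [gradient, gradient, gradient, h.fderiv]
  simp

/-- Pass to a subsequence. Pointwise convergence is needed because the approximants are composed
with nonlinear functions. -/
theorem Approximates.exists_ae_tendsto (hΩo : IsOpen Ω) (hΩb : Bornology.IsBounded Ω)
    {u f : EuclideanSpace ℝ (Fin n) → ℝ} {g : EuclideanSpace ℝ (Fin n) → EuclideanSpace ℝ (Fin n)}
    {W : ℕ → EuclideanSpace ℝ (Fin n) → ℝ} (hW : Approximates Ω f u g W)
    (hu : AEStronglyMeasurable u (volume.restrict Ω)) :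
    ∃ W', Approximates Ω f u g W' ∧
      ∀ᵐ x ∂(volume.restrict Ω), Tendsto (fun k => W' k x) atTop (𝓝 (u x)) := by
  obtain ⟨ns, hns, hae⟩ := hW.conv.exists_subseq_ae
    (fun k => (memLp_restrict_of_continuous hΩb hΩo.measurableSet (hW.contDiff k).continuous).1) hu
  exact ⟨fun k => W (ns k), ⟨fun k => hW.contDiff _, hW.conv.comp hns, hW.conv_gradient.comp hns,
    hW.conv_boundary.comp hns⟩, hae⟩

theorem notMem_of_mem_frontier (hΩo : IsOpen Ω) {x : EuclideanSpace ℝ (Fin n)}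
    (hx : x ∈ frontier Ω) : x ∉ Ω :=
  fun h => (hΩo.inter_frontier_eq.subset ⟨h, hx⟩).elim

/-- The minimizer is weakly superharmonic: variations in the direction of a nonnegative test
function, and more generally of any test function that is allowed by the obstacle. -/
theorem integral_inner_gradient_nonneg_of_isMinimizer (hΩo : IsOpen Ω)
    (hΩb : Bornology.IsBounded Ω) {φ f u : EuclideanSpace ℝ (Fin n) → ℝ}
    {gu : EuclideanSpace ℝ (Fin n) → EuclideanSpace ℝ (Fin n)}
    (hadm : IsAdmissible Ω φ f u gu)
    (hmin : ∀ w gw, IsAdmissible Ω φ f w gw →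
      ∫ x in Ω, ‖gu x‖ ^ 2 / 2 ≤ ∫ x in Ω, ‖gw x‖ ^ 2 / 2)
    {ψ : EuclideanSpace ℝ (Fin n) → ℝ} (hψ : ContDiff ℝ 1 ψ) (hs : tsupport ψ ⊆ Ω)
    {t₀ : ℝ} (ht₀ : 0 < t₀)
    (hobs : ∀ t, 0 < t → t ≤ t₀ → ∀ᵐ x ∂(volume.restrict Ω), φ x ≤ u x + t * ψ x) :
    0 ≤ ∫ x in Ω, inner ℝ (gu x) (gradient ψ x) := by
  obtain ⟨W, hW⟩ := hadm.hasTrace.exists_approximates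
  have m := hΩo.measurableSet
  refine integral_inner_nonneg_of_isMinimizer hΩo hΩb hadm hmin hW (fun _ => hψ)
    (fun _ x hx => image_eq_zero_of_notMem_tsupport fun h => notMem_of_mem_frontier hΩo hx (hs h))
    (memLp_restrict_of_continuous hΩb m hψ.continuous).1
    (memLp_restrict_of_continuous hΩb m (continuous_gradient hψ)).1
    (ConvL2.const _) (ConvL2.const _) ht₀ hobs

/-- The one-sided Lewy–Stampacchia inequality: where the obstacle has Lipschitz gradient, the
Laplacian of the minimizer is weakly bounded from below. -/
theorem integral_inner_gradient_le_of_isMinimizer (hΩo : IsOpen Ω) (hΩb : Bornology.IsBounded Ω)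
    {φ f u : EuclideanSpace ℝ (Fin n) → ℝ}
    {gu : EuclideanSpace ℝ (Fin n) → EuclideanSpace ℝ (Fin n)}
    (hadm : IsAdmissible Ω φ f u gu)
    (hmin : ∀ w gw, IsAdmissible Ω φ f w gw →
      ∫ x in Ω, ‖gu x‖ ^ 2 / 2 ≤ ∫ x in Ω, ‖gw x‖ ^ 2 / 2)
    (hφ : ContDiffOn ℝ 1 φ Ω) {C : ℝ≥0} (hφC : LipschitzOnWith C (fderiv ℝ φ) Ω)
    {ψ : EuclideanSpace ℝ (Fin n) → ℝ} (hψ : ContDiff ℝ ∞ ψ) (hc : HasCompactSupport ψ)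
    (hs : tsupport ψ ⊆ Ω) (h0 : ∀ x, 0 ≤ ψ x) :
    ∫ x in Ω, inner ℝ (gu x) (gradient ψ x) ≤ n * C * ∫ x, ψ x := by
  have m := hΩo.measurableSet
  have hψ1 : ContDiff ℝ 1 ψ := hψ.of_le (by simp)
  have hiψ : Integrable ψ := hψ.continuous.integrable_of_hasCompactSupport hc
  obtain ⟨φ', O, hφ', hO, hKO, hOΩ, heq⟩ := exists_contDiff_eqOn_nhds hΩo hφ hc.isCompact hs
  obtain ⟨W₀, hW₀⟩ := hadm.hasTrace.exists_approximates
  have Lu := hadm.isW12.memLp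
  have Lgu := hadm.isW12.memLp_grad
  obtain ⟨W, hW, hae⟩ := hW₀.exists_ae_tendsto hΩo hΩb Lu.1
  obtain ⟨M, hM⟩ := hc.exists_bound_of_continuous hψ.continuous
  have hM0 : 0 ≤ M := (norm_nonneg _).trans (hM 0)
  have hgradφ : ∀ x ∈ O, gradient φ' x = gradient φ x := by
    intro x hx
    rw [gradient, gradient, (heq.eventuallyEq_of_mem (hO.mem_nhds hx)).fderiv_eq]
  -- the statement up to an error of order `ε`
  suffices hε : ∀ ε : ℝ, 0 < ε → ∫ x in Ω, inner ℝ (gu x) (gradient ψ x) ≤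
      n * C * (∫ x, ψ x) + ε * (2 * ∫ x, |lap ψ x|) by
    have hlim : Tendsto (fun ε : ℝ => n * C * (∫ x, ψ x) + ε * (2 * ∫ x, |lap ψ x|)) (𝓝[>] 0)
        (𝓝 (n * C * ∫ x, ψ x)) := by
      have : Continuous fun ε : ℝ => n * C * (∫ x, ψ x) + ε * (2 * ∫ x, |lap ψ x|) := by fun_prop
      simpa using (this.tendsto 0).mono_left nhdsWithin_le_nhds
    exact ge_of_tendsto hlim (by filter_upwards [self_mem_nhdsWithin] with ε h using hε ε h)
  intro ε hε
  set H : ℝ → ℝ := fun s => ε ^ 2 / (ε ^ 2 + s ^ 2) with hHdef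
  set H' : ℝ → ℝ := fun s => -(2 * ε ^ 2 * s) / (ε ^ 2 + s ^ 2) ^ 2 with hH'def
  have hHd : ∀ s, HasDerivAt H (H' s) s := hasDerivAt_bumpProfile hε
  have hHc : Continuous H := (contDiff_bumpProfile hε (m := 0)).continuous
  have hH'c : Continuous H' := by
    refine Continuous.div (by fun_prop) (by fun_prop) fun s => ?_
    positivity
  have hH'b : ∀ s, |H' s| ≤ 1 / ε := abs_deriv_bumpProfile_le hε
  have hH0 : ∀ s, 0 ≤ H s := fun s => by positivity
  have hH1 : ∀ s, H s ≤ 1 := fun s => by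
    rw [hHdef]; exact (div_le_one (by positivity)).2 (by nlinarith [sq_nonneg s])
  have hHb : ∀ s, |H s| ≤ 1 := fun s => by rw [abs_of_nonneg (hH0 s)]; exact hH1 s
  -- approximants of `u - φ'` and of its weak gradient
  let s : ℕ → EuclideanSpace ℝ (Fin n) → ℝ := fun k x => W k x - φ' x
  let s₀ : EuclideanSpace ℝ (Fin n) → ℝ := fun x => u x - φ' x
  let g : ℕ → EuclideanSpace ℝ (Fin n) → EuclideanSpace ℝ (Fin n) :=
    fun k x => gradient (W k) x - gradient φ' x
  let σ : EuclideanSpace ℝ (Fin n) → EuclideanSpace ℝ (Fin n) := fun x => gu x - gradient φ' x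
  have hsC : ∀ k, ContDiff ℝ 1 (s k) := fun k => (hW.contDiff k).sub hφ'
  have hgs : ∀ k x, gradient (s k) x = g k x := fun k x =>
    gradient_sub_eq ((hW.contDiff k).differentiable one_ne_zero x)
      (hφ'.differentiable one_ne_zero x)
  have hgc : ∀ k, Continuous (g k) := fun k =>
    (continuous_gradient (hW.contDiff k)).sub (continuous_gradient hφ')
  have Lgφ := memLp_restrict_of_continuous hΩb m (continuous_gradient hφ')
  have Lgψ := memLp_restrict_of_continuous hΩb m (continuous_gradient hψ1)
  have Lψ := memLp_restrict_of_continuous hΩb m hψ.continuous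
  have Lσ : MemLp σ 2 (volume.restrict Ω) := Lgu.sub Lgφ
  have Lg : ∀ k, MemLp (g k) 2 (volume.restrict Ω) := fun k =>
    memLp_restrict_of_continuous hΩb m (hgc k)
  have cg : ConvL2 (volume.restrict Ω) g σ := by
    refine Tendsto.congr (fun k => ?_) hW.conv_gradient
    congr 1
    ext1 x
    simp [g, σ]
  have mφ' : AEStronglyMeasurable φ' (volume.restrict Ω) := hφ'.continuous.aestronglyMeasurable
  have ms₀ : AEStronglyMeasurable s₀ (volume.restrict Ω) := Lu.1.sub mφ'
  have hsae : ∀ᵐ x ∂(volume.restrict Ω), Tendsto (fun k => s k x) atTop (𝓝 (s₀ x)) := by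
    filter_upwards [hae] with x hx using hx.sub_const _
  have mH : ∀ k, AEStronglyMeasurable (fun x => H (s k x)) (volume.restrict Ω) := fun k =>
    (hHc.comp (hsC k).continuous).aestronglyMeasurable
  have mH₀ : AEStronglyMeasurable (fun x => H (s₀ x)) (volume.restrict Ω) :=
    hHc.comp_aestronglyMeasurable ms₀
  have hHae : ∀ᵐ x ∂(volume.restrict Ω), Tendsto (fun k => H (s k x)) atTop (𝓝 (H (s₀ x))) := by
    filter_upwards [hsae] with x hx using (hHc.tendsto _).comp hx
  have mH' : ∀ k, AEStronglyMeasurable (fun x => ψ x * H' (s k x)) (volume.restrict Ω) := fun k =>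
    (hψ.continuous.mul (hH'c.comp (hsC k).continuous)).aestronglyMeasurable
  have mH'₀ : AEStronglyMeasurable (fun x => ψ x * H' (s₀ x)) (volume.restrict Ω) :=
    hψ.continuous.aestronglyMeasurable.mul (hH'c.comp_aestronglyMeasurable ms₀)
  have hH'ae : ∀ᵐ x ∂(volume.restrict Ω),
      Tendsto (fun k => ψ x * H' (s k x)) atTop (𝓝 (ψ x * H' (s₀ x))) := by
    filter_upwards [hsae] with x hx using ((hH'c.tendsto _).comp hx).const_mul _
  have hψH'b : ∀ (s : EuclideanSpace ℝ (Fin n) → ℝ) x, |ψ x * H' (s x)| ≤ M * (1 / ε) := by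
    intro s x
    rw [abs_mul]
    exact mul_le_mul (hM x) (hH'b _) (abs_nonneg _) hM0
  -- the cut-off test function `ψ H(u - φ')`
  let Z : ℕ → EuclideanSpace ℝ (Fin n) → ℝ := fun k x => H (s k x) * ψ x
  let gZ : EuclideanSpace ℝ (Fin n) → EuclideanSpace ℝ (Fin n) :=
    fun x => H (s₀ x) • gradient ψ x + (ψ x * H' (s₀ x)) • σ x
  have hZC : ∀ k, ContDiff ℝ 1 (Z k) := fun k =>
    ((contDiff_bumpProfile hε).comp (hsC k)).mul hψ1
  have hgZk : ∀ k x, gradient (Z k) x =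
      H (s k x) • gradient ψ x + (ψ x * H' (s k x)) • g k x := by
    intro k x
    have d1 := (hsC k).differentiable one_ne_zero x
    have d2 : DifferentiableAt ℝ (fun y => H (s k y)) x :=
      ((contDiff_bumpProfile hε).comp (hsC k)).differentiable one_ne_zero x
    have e := gradient_mul_eq d2 (hψ1.differentiable one_ne_zero x)
    rw [gradient_comp_real d1 (hHd _), hgs, smul_smul] at e
    exact e
  have cZ : ConvL2 (volume.restrict Ω) Z (fun x => H (s₀ x) * ψ x) :=
    (ConvL2.const ψ).smul_of_bounded (fun _ => Lψ.1) Lψ (fun k x => hHb _) mH mH₀ hHae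
  have cHψ : ConvL2 (volume.restrict Ω) (fun k x => H (s k x) • gradient ψ x)
      (fun x => H (s₀ x) • gradient ψ x) :=
    (ConvL2.const (gradient ψ)).smul_of_bounded (fun _ => Lgψ.1) Lgψ (fun k x => hHb _) mH mH₀ hHae
  have cH'g : ConvL2 (volume.restrict Ω) (fun k x => (ψ x * H' (s k x)) • g k x)
      (fun x => (ψ x * H' (s₀ x)) • σ x) :=
    cg.smul_of_bounded (fun k => (Lg k).1) Lσ (fun k x => hψH'b _ x) mH' mH'₀ hH'ae
  have mgZ : AEStronglyMeasurable gZ (volume.restrict Ω) :=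
    (mH₀.smul Lgψ.1).add (mH'₀.smul Lσ.1)
  have cgZ : ConvL2 (volume.restrict Ω) (fun k => gradient (Z k)) gZ := by
    have : (fun k => gradient (Z k)) =
        fun k x => H (s k x) • gradient ψ x + (ψ x * H' (s k x)) • g k x := by
      ext1 k; ext1 x; exact hgZk k x
    rw [this]
    exact cHψ.add cH'g (fun k => (mH k).smul Lgψ.1) (mH₀.smul Lgψ.1)
      (fun k => (mH' k).smul (Lg k).1) (mH'₀.smul Lσ.1)
  have LgZk : ∀ k, MemLp (gradient (Z k)) 2 (volume.restrict Ω) := fun k =>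
    memLp_restrict_of_continuous hΩb m (continuous_gradient (hZC k))
  have LgZ : MemLp gZ 2 (volume.restrict Ω) := cgZ.memLp LgZk mgZ
  have hZsupp : ∀ k, tsupport (Z k) ⊆ tsupport ψ := fun k => tsupport_mul_subset_right
  have hs₀ : ∀ᵐ x ∂(volume.restrict Ω), x ∈ O → 0 ≤ s₀ x := by
    filter_upwards [hadm.obstacle_le] with x hx hxO
    simp only [s₀, heq hxO]
    linarith
  have hψO : ∀ x, x ∉ O → ψ x = 0 := fun x hx =>
    image_eq_zero_of_notMem_tsupport fun h => hx (hKO h)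
  -- minimality
  have hvar : 0 ≤ ∫ x in Ω, inner ℝ (gu x) (gZ x - gradient ψ x) := by
    refine integral_inner_nonneg_of_isMinimizer hΩo hΩb hadm hmin hW
      (Z := fun k x => Z k x - ψ x) (ζ := fun x => H (s₀ x) * ψ x - ψ x)
      (fun k => (hZC k).sub hψ1) ?_ ?_ (mgZ.sub Lgψ.1) ?_ ?_
      (t₀ := ε / (M + 1)) (by positivity) ?_
    · intro k x hx
      have : ψ x = 0 :=
        image_eq_zero_of_notMem_tsupport fun h => notMem_of_mem_frontier hΩo hx (hs h)
      simp [Z, this]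
    · exact (mH₀.mul Lψ.1).sub Lψ.1
    · refine Tendsto.congr (fun k => ?_) cZ
      congr 1
      ext1 x
      simp
    · refine Tendsto.congr (fun k => ?_) cgZ
      congr 1
      ext1 x
      beta_reduce
      rw [gradient_sub_eq ((hZC k).differentiable one_ne_zero x)
        (hψ1.differentiable one_ne_zero x)]
      simp
    -- On `O`, `tψ ≤ ε` and `1 - H(s₀) ≤ s₀/(2ε)`, so `u` is lowered by at most `s₀/2`, half of its
    -- height above the obstacle.
    · intro t ht htM
      filter_upwards [hs₀, hadm.obstacle_le] with x hx hx'
      by_cases hxO : x ∈ O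
      · have h1 := hx hxO
        have h2 : 1 - H (s₀ x) ≤ s₀ x / (2 * ε) := by
          have : 1 - H (s₀ x) = s₀ x ^ 2 / (ε ^ 2 + s₀ x ^ 2) := by
            simp only [hHdef]; field_simp; ring
          rw [this, div_le_div_iff₀ (by positivity) (by positivity)]
          -- After clearing denominators the claim is `s₀ (ε - s₀)² ≥ 0`.
          nlinarith [mul_nonneg h1 (sq_nonneg (ε - s₀ x))]
        have h3 : ψ x ≤ M := (le_abs_self _).trans (hM x)
        have h4 : t * (M + 1) ≤ ε := (le_div_iff₀ (by positivity)).1 htM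
        have h5 : t * ψ x ≤ ε := by nlinarith
        have h6 : (t * ψ x) * (1 - H (s₀ x)) ≤ ε * (s₀ x / (2 * ε)) :=
          mul_le_mul h5 h2 (by linarith [hH1 (s₀ x)]) hε.le
        have h7 : ε * (s₀ x / (2 * ε)) = s₀ x / 2 := by field_simp
        have h8 : s₀ x = u x - φ x := by simp only [s₀, heq hxO]
        have h9 : t * (H (s₀ x) * ψ x - ψ x) = -((t * ψ x) * (1 - H (s₀ x))) := by ring
        linarith
      · simp [hψO x hxO, hx']
  -- Write `∇u = ∇φ' + σ`. The first part is estimated by the regularity of the obstacle, the second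
  -- by monotonicity and smallness of the primitive of `H`.
  have hsplit : ∫ x in Ω, inner ℝ (gu x) (gradient ψ x) ≤
      (∫ x in Ω, inner ℝ (gradient φ' x) (gZ x)) + ∫ x in Ω, inner ℝ (σ x) (gZ x) := by
    rw [← integral_add (integrable_inner_of_memLp Lgφ LgZ) (integrable_inner_of_memLp Lσ LgZ)]
    have : ∀ x, inner ℝ (gradient φ' x) (gZ x) + inner ℝ (σ x) (gZ x) = inner ℝ (gu x) (gZ x) := by
      intro x
      rw [← inner_add_left]
      simp [σ]
    simp_rw [this]
    simp_rw [inner_sub_right] at hvar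
    rw [integral_sub (integrable_inner_of_memLp Lgu LgZ)
      (integrable_inner_of_memLp Lgu Lgψ)] at hvar
    linarith
  -- Before the limit, `Z k` is a `C¹` test function with `0 ≤ Z k ≤ ψ`, to which the Lipschitz
  -- bound applies.
  have hI1 : ∫ x in Ω, inner ℝ (gradient φ' x) (gZ x) ≤ n * C * ∫ x, ψ x := by
    refine le_of_tendsto ((ConvL2.const (gradient φ')).tendsto_integral_inner cgZ
      (fun _ => Lgφ) Lgφ LgZk LgZ) (.of_forall fun k => ?_)
    have hz : ∀ x, x ∉ Ω → inner ℝ (gradient φ' x) (gradient (Z k) x) = 0 := by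
      intro x hx
      rw [gradient_eq_zero_of_notMem_tsupport fun h => hx (hs (hZsupp k h)), inner_zero_right]
    rw [setIntegral_eq_integral_of_forall_compl_eq_zero hz]
    have he : ∀ x, inner ℝ (gradient φ' x) (gradient (Z k) x) =
        inner ℝ (gradient φ x) (gradient (Z k) x) := by
      intro x
      by_cases hx : x ∈ O
      · rw [hgradφ x hx]
      · rw [gradient_eq_zero_of_notMem_tsupport fun h => hx (hKO (hZsupp k h)), inner_zero_right,
          inner_zero_right]
    simp_rw [he]
    refine (integral_inner_gradient_le_of_lipschitz hφC (hZC k) hc.mul_left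
      ((hZsupp k).trans hs) fun x => mul_nonneg (hH0 _) (h0 x)).trans ?_
    refine mul_le_mul_of_nonneg_left (integral_mono ?_ hiψ fun x => ?_) (by positivity)
    · exact (hZC k).continuous.integrable_of_hasCompactSupport hc.mul_left
    · exact mul_le_of_le_one_left (h0 x) (hH1 _)
  have cHg : ConvL2 (volume.restrict Ω) (fun k x => H (s k x) • g k x)
      (fun x => H (s₀ x) • σ x) :=
    cg.smul_of_bounded (fun k => (Lg k).1) Lσ (fun k x => hHb _) mH mH₀ hHae
  have LHg : ∀ k, MemLp (fun x => H (s k x) • g k x) 2 (volume.restrict Ω) := fun k =>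
    memLp_restrict_of_continuous hΩb m ((hHc.comp (hsC k).continuous).smul (hgc k))
  have LHσ : MemLp (fun x => H (s₀ x) • σ x) 2 (volume.restrict Ω) :=
    cHg.memLp LHg (mH₀.smul Lσ.1)
  -- The discarded term is `ψ H'(s₀) |σ|²`, nonpositive because `H` decreases on `[0, ∞)` and `s₀ ≥
  -- 0` where `ψ ≠ 0`.
  have hI2 : ∫ x in Ω, inner ℝ (σ x) (gZ x) ≤ ∫ x in Ω, inner ℝ (H (s₀ x) • σ x) (gradient ψ x) := by
    refine integral_mono_ae (integrable_inner_of_memLp Lσ LgZ)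
      (integrable_inner_of_memLp LHσ Lgψ) ?_
    filter_upwards [hs₀] with x hx
    simp only [gZ]
    rw [inner_add_right, inner_smul_right, inner_smul_right, inner_smul_left,
      real_inner_self_eq_norm_sq]
    simp only [conj_trivial]
    have : ψ x * H' (s₀ x) ≤ 0 := by
      by_cases hxO : x ∈ O
      · refine mul_nonpos_of_nonneg_of_nonpos (h0 x) ?_
        have := hx hxO
        simp only [hH'def]
        refine div_nonpos_of_nonpos_of_nonneg ?_ (by positivity)
        have : 0 ≤ 2 * ε ^ 2 * s₀ x := by positivity
        linarith
      · simp [hψO x hxO]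
    nlinarith [sq_nonneg ‖σ x‖]
  -- For the approximants, `H(s) ∇s` is the gradient of `ε arctan(s/ε)`. Moving the other derivative
  -- onto `ψ` leaves a function bounded by `2ε` against `Δψ`.
  have hI3 : ∫ x in Ω, inner ℝ (H (s₀ x) • σ x) (gradient ψ x) ≤ ε * (2 * ∫ x, |lap ψ x|) := by
    refine le_of_tendsto (cHg.tendsto_integral_inner (ConvL2.const (gradient ψ)) LHg LHσ
      (fun _ => Lgψ) Lgψ) (.of_forall fun k => ?_)
    have hz : ∀ x, x ∉ Ω → inner ℝ (H (s k x) • g k x) (gradient ψ x) = 0 := by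
      intro x hx
      rw [gradient_eq_zero_of_notMem_tsupport fun h => hx (hs h), inner_zero_right]
    rw [setIntegral_eq_integral_of_forall_compl_eq_zero hz]
    have hGC : ContDiff ℝ 1 fun x => ε * Real.arctan (s k x / ε) :=
      contDiff_const.mul (((hsC k).div_const ε).arctan)
    have he : ∀ x, H (s k x) • g k x = gradient (fun x => ε * Real.arctan (s k x / ε)) x := by
      intro x
      rw [← hgs]
      exact (gradient_comp_real ((hsC k).differentiable one_ne_zero x)
        (hasDerivAt_mul_arctan hε _)).symm
    simp_rw [he]
    rw [integral_inner_gradient_eq hGC hψ hc, ← integral_neg, ← integral_const_mul,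
      ← integral_const_mul]
    have hclap : HasCompactSupport (lap ψ) :=
      hc.of_isClosed_subset (isClosed_tsupport _) (closure_minimal (fun x hx => by
        by_contra h
        exact hx (lap_eq_zero_of_notMem_tsupport h)) (isClosed_tsupport _))
    have hcl := continuous_lap hψ
    refine integral_mono ((hGC.continuous.mul hcl).integrable_of_hasCompactSupport
      hclap.mul_left).neg
      (((hcl.integrable_of_hasCompactSupport hclap).abs.const_mul _).const_mul _) fun x => ?_
    have h1 := abs_mul_arctan_le hε (s k x)
    calc -(ε * Real.arctan (s k x / ε) * lap ψ x) ≤ |ε * Real.arctan (s k x / ε) * lap ψ x| :=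
          neg_le_abs _
      _ = |ε * Real.arctan (s k x / ε)| * |lap ψ x| := abs_mul _ _
      _ ≤ 2 * ε * |lap ψ x| := mul_le_mul_of_nonneg_right h1 (abs_nonneg _)
      _ = ε * (2 * |lap ψ x|) := by ring
  linarith

end LewyStampacchia

/-! ### A radial averaging kernel and its derivative in the radius. -/

section RadialKernel

/-- A smooth radial profile `κ`, supported in `(-∞, 1]` and nonincreasing, normalized so that
`y ↦ -2 κ'(|y|²)` is a probability density on `ℝⁿ`. -/
structure RadialKernel (n : ℕ) where
  κ : ℝ → ℝ
  contDiff : ContDiff ℝ ∞ κ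
  nonneg : ∀ s, 0 ≤ κ s
  eq_zero : ∀ s, 1 ≤ s → κ s = 0
  deriv_nonpos : ∀ s, deriv κ s ≤ 0
  deriv_neg : ∃ c : ℝ, 0 < c ∧ ∀ s, s ≤ 1 / 4 → 0 ≤ s → deriv κ s ≤ -c
  integral_eq_one : ∫ y : EuclideanSpace ℝ (Fin n), -2 * deriv κ (‖y‖ ^ 2) = 1

theorem hasDerivAt_expNegInvGlue (x : ℝ) :
    HasDerivAt expNegInvGlue (x⁻¹ ^ 2 * expNegInvGlue x) x := by
  have := expNegInvGlue.hasDerivAt_polynomial_eval_inv_mul 1 x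
  simpa using this

theorem hasDerivAt_expNegInvGlue_one_sub (s : ℝ) :
    HasDerivAt (fun s => expNegInvGlue (1 - s))
      (-((1 - s)⁻¹ ^ 2 * expNegInvGlue (1 - s))) s := by
  have := (hasDerivAt_expNegInvGlue (1 - s)).comp s ((hasDerivAt_id s).const_sub 1)
  simpa [Function.comp_def] using this

theorem nonempty_radialKernel (n : ℕ) : Nonempty (RadialKernel n) := by
  -- The profile is `exp(-1/(1 - s))` for `s < 1` and zero beyond, to be divided by the integral of
  -- the density it generates.
  set κ₀ : ℝ → ℝ := fun s => expNegInvGlue (1 - s) with hκ₀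
  have hC : ContDiff ℝ ∞ κ₀ := expNegInvGlue.contDiff.comp (contDiff_const.sub contDiff_id)
  have hd : ∀ s, deriv κ₀ s = -((1 - s)⁻¹ ^ 2 * expNegInvGlue (1 - s)) := fun s =>
    (hasDerivAt_expNegInvGlue_one_sub s).deriv
  have hd0 : ∀ s, deriv κ₀ s ≤ 0 := fun s => by
    rw [hd]; have := expNegInvGlue.nonneg (1 - s); nlinarith [mul_nonneg (sq_nonneg (1 - s)⁻¹) this]
  have hdn : ∀ s, s < 1 → deriv κ₀ s < 0 := fun s hs => by
    rw [hd]
    have h1 := expNegInvGlue.pos_of_pos (sub_pos.2 hs)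
    have h2 : 0 < (1 - s)⁻¹ := inv_pos.2 (sub_pos.2 hs)
    have : 0 < (1 - s)⁻¹ ^ 2 * expNegInvGlue (1 - s) := by positivity
    linarith
  have hdc : Continuous (deriv κ₀) := hC.continuous_deriv (by simp)
  have hz : ∀ s, 1 ≤ s → κ₀ s = 0 := fun s hs =>
    expNegInvGlue.zero_of_nonpos (by linarith)
  let w : EuclideanSpace ℝ (Fin n) → ℝ := fun y => -2 * deriv κ₀ (‖y‖ ^ 2)
  have hwc : Continuous w := continuous_const.mul (hdc.comp (continuous_norm.pow 2))
  have hws : HasCompactSupport w := by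
    refine HasCompactSupport.intro (isCompact_closedBall (0 : EuclideanSpace ℝ (Fin n)) 1)
      fun y hy => ?_
    rw [mem_closedBall_zero_iff, not_le] at hy
    have : (1 : ℝ) - ‖y‖ ^ 2 ≤ 0 := by nlinarith
    simp [w, hd, expNegInvGlue.zero_of_nonpos this]
  have hw0 : ∀ y, 0 ≤ w y := fun y => by have := hd0 (‖y‖ ^ 2); simp only [w]; linarith
  have hc₀ : 0 < ∫ y, w y := by
    refine hwc.integral_pos_of_hasCompactSupport_nonneg_nonzero hws hw0 (x := 0) ?_
    have := hdn 0 one_pos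
    simp only [w, norm_zero]
    norm_num
    exact this.ne
  set c₀ := ∫ y, w y with hc₀def
  have hdm : deriv (fun s => c₀⁻¹ * κ₀ s) = fun s => c₀⁻¹ * deriv κ₀ s := by
    ext1 s
    exact deriv_const_mul _ ((hC.differentiable (by simp)) s)
  have hi : 0 < c₀⁻¹ := inv_pos.2 hc₀
  obtain ⟨s₀, hs₀, hmax⟩ := (isCompact_Icc (a := (0 : ℝ)) (b := 1 / 4)).exists_isMaxOn
    ⟨0, by norm_num⟩ hdc.continuousOn
  refine ⟨⟨fun s => c₀⁻¹ * κ₀ s, contDiff_const.mul hC,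
    fun s => mul_nonneg hi.le (expNegInvGlue.nonneg _), fun s hs => by simp [hz s hs], ?_, ?_, ?_⟩⟩
  · intro s
    rw [hdm]
    exact mul_nonpos_of_nonneg_of_nonpos hi.le (hd0 s)
  · refine ⟨c₀⁻¹ * -deriv κ₀ s₀, mul_pos hi (neg_pos.2 (hdn s₀ (by linarith [hs₀.2]))),
      fun s h1 h2 => ?_⟩
    rw [hdm]
    have : deriv κ₀ s ≤ deriv κ₀ s₀ := hmax ⟨h2, h1⟩
    simp only
    nlinarith
  · rw [hdm]
    have : ∀ y : EuclideanSpace ℝ (Fin n), -2 * (fun s => c₀⁻¹ * deriv κ₀ s) (‖y‖ ^ 2) =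
        c₀⁻¹ * w y := fun y => by simp only [w]; ring
    simp_rw [this]
    rw [integral_const_mul, ← hc₀def, inv_mul_cancel₀ hc₀.ne']

variable {n : ℕ} (k : RadialKernel n)

namespace RadialKernel

/-- The density `y ↦ -2 κ'(|y|²)`. -/
noncomputable def η (y : EuclideanSpace ℝ (Fin n)) : ℝ := -2 * deriv k.κ (‖y‖ ^ 2)

/-- The weighted average of `U` at `x`, at scale `r`. -/
noncomputable def avg (r : ℝ) (U : EuclideanSpace ℝ (Fin n) → ℝ) (x : EuclideanSpace ℝ (Fin n)) :
    ℝ :=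
  ∫ z, U z * (r⁻¹ ^ n * k.η (r⁻¹ • (z - x)))

/-- The test function whose Laplacian is the derivative of the averaging kernel in `r`. -/
noncomputable def bump (r : ℝ) (x z : EuclideanSpace ℝ (Fin n)) : ℝ :=
  r * r⁻¹ ^ n * k.κ (r⁻¹ ^ 2 * ‖z - x‖ ^ 2)

theorem contDiff_deriv : ContDiff ℝ ∞ (deriv k.κ) :=
  (contDiff_infty_iff_deriv.1 k.contDiff).2

theorem contDiff_deriv_deriv : ContDiff ℝ ∞ (deriv (deriv k.κ)) :=
  (contDiff_infty_iff_deriv.1 k.contDiff_deriv).2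

theorem deriv_eq_zero {s : ℝ} (hs : 1 < s) : deriv k.κ s = 0 := by
  have : k.κ =ᶠ[𝓝 s] fun _ => 0 := by
    filter_upwards [lt_mem_nhds hs] with t ht using k.eq_zero t ht.le
  rw [this.deriv_eq, deriv_const]

theorem deriv_deriv_eq_zero {s : ℝ} (hs : 1 < s) : deriv (deriv k.κ) s = 0 := by
  have : deriv k.κ =ᶠ[𝓝 s] fun _ => 0 := by
    filter_upwards [lt_mem_nhds hs] with t ht using k.deriv_eq_zero ht
  rw [this.deriv_eq, deriv_const]

theorem η_nonneg (y : EuclideanSpace ℝ (Fin n)) : 0 ≤ k.η y := by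
  have := k.deriv_nonpos (‖y‖ ^ 2)
  rw [η]; linarith

theorem η_eq_zero {y : EuclideanSpace ℝ (Fin n)} (hy : 1 < ‖y‖) : k.η y = 0 := by
  rw [η, k.deriv_eq_zero (by nlinarith), mul_zero]

theorem η_neg (y : EuclideanSpace ℝ (Fin n)) : k.η (-y) = k.η y := by
  simp [η]

theorem contDiff_η : ContDiff ℝ ∞ k.η :=
  contDiff_const.mul (k.contDiff_deriv.comp (contDiff_norm_sq ℝ))

theorem hasCompactSupport_η : HasCompactSupport k.η :=
  HasCompactSupport.intro (isCompact_closedBall (0 : EuclideanSpace ℝ (Fin n)) 1) fun y hy => by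
    rw [mem_closedBall_zero_iff, not_le] at hy
    exact k.η_eq_zero hy

theorem integral_η : ∫ y, k.η y = 1 := k.integral_eq_one

theorem exists_η_le : ∃ M : ℝ, 0 < M ∧ ∀ y, k.η y ≤ M := by
  obtain ⟨M, hM⟩ := k.hasCompactSupport_η.exists_bound_of_continuous k.contDiff_η.continuous
  exact ⟨max M 1, by positivity, fun y => ((le_abs_self _).trans (hM y)).trans (le_max_left _ _)⟩

theorem η_scaled_eq_zero {r : ℝ} (hr : 0 < r) {x z : EuclideanSpace ℝ (Fin n)}
    (h : r < dist z x) : k.η (r⁻¹ • (z - x)) = 0 := by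
  refine k.η_eq_zero ?_
  rw [norm_smul, norm_inv, Real.norm_eq_abs, abs_of_pos hr, ← dist_eq_norm]
  rw [inv_mul_eq_div, lt_div_iff₀ hr]
  linarith

theorem contDiff_bump (r : ℝ) (x : EuclideanSpace ℝ (Fin n)) : ContDiff ℝ ∞ (k.bump r x) :=
  contDiff_const.mul (k.contDiff.comp (contDiff_const.mul
    ((contDiff_id.sub contDiff_const).norm_sq ℝ)))

theorem bump_nonneg {r : ℝ} (hr : 0 < r) (x z : EuclideanSpace ℝ (Fin n)) : 0 ≤ k.bump r x z := by
  have := k.nonneg (r⁻¹ ^ 2 * ‖z - x‖ ^ 2)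
  rw [bump]; positivity

theorem tsupport_bump_subset {r : ℝ} (hr : 0 < r) (x : EuclideanSpace ℝ (Fin n)) :
    tsupport (k.bump r x) ⊆ Metric.closedBall x r := by
  refine closure_minimal (fun z hz => ?_) Metric.isClosed_closedBall
  by_contra h
  rw [Metric.mem_closedBall, not_le, dist_eq_norm] at h
  refine hz ?_
  rw [bump, k.eq_zero, mul_zero]
  rw [← mul_pow, inv_mul_eq_div]
  have : 1 < ‖z - x‖ / r := (one_lt_div hr).2 h
  nlinarith

theorem hasCompactSupport_bump {r : ℝ} (hr : 0 < r) (x : EuclideanSpace ℝ (Fin n)) :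
    HasCompactSupport (k.bump r x) :=
  (isCompact_closedBall x r).of_isClosed_subset (isClosed_tsupport _) (k.tsupport_bump_subset hr x)

theorem fderiv_radial {θ : ℝ → ℝ} (hθ : Differentiable ℝ θ) (c : ℝ)
    (x z e : EuclideanSpace ℝ (Fin n)) :
    fderiv ℝ (fun z => θ (c * ‖z - x‖ ^ 2)) z e =
      deriv θ (c * ‖z - x‖ ^ 2) * (2 * c * inner ℝ (z - x) e) := by
  have h1 : HasFDerivAt (fun z : EuclideanSpace ℝ (Fin n) => c * ‖z - x‖ ^ 2)
      (c • (2 • (innerSL ℝ (z - x)).comp (ContinuousLinearMap.id ℝ _))) z :=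
    (((hasFDerivAt_id z).sub_const x).norm_sq).const_mul c
  have h2 := (hθ (c * ‖z - x‖ ^ 2)).hasDerivAt.comp_hasFDerivAt z h1
  have h3 : fderiv ℝ (fun z => θ (c * ‖z - x‖ ^ 2)) z = _ := h2.fderiv
  rw [h3]
  rw [ContinuousLinearMap.comp_id]
  change deriv θ (c * ‖z - x‖ ^ 2) * (c * ((2 : ℕ) • inner ℝ (z - x) e)) = _
  rw [nsmul_eq_mul]
  push_cast
  ring

theorem lap_radial {θ : ℝ → ℝ} (hθ : ContDiff ℝ ∞ θ) (c : ℝ)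
    (x z : EuclideanSpace ℝ (Fin n)) :
    lap (fun z => θ (c * ‖z - x‖ ^ 2)) z =
      4 * c ^ 2 * ‖z - x‖ ^ 2 * deriv (deriv θ) (c * ‖z - x‖ ^ 2) +
        2 * n * c * deriv θ (c * ‖z - x‖ ^ 2) := by
  have hθ' : ContDiff ℝ ∞ (deriv θ) := (contDiff_infty_iff_deriv.1 hθ).2
  have hD : Differentiable ℝ θ := hθ.differentiable (by simp)
  have hD' : Differentiable ℝ (deriv θ) := hθ'.differentiable (by simp)
  have hi : ∀ i : Fin n, fderiv ℝ (fun y => fderiv ℝ (fun z => θ (c * ‖z - x‖ ^ 2)) y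
      (EuclideanSpace.single i 1)) z (EuclideanSpace.single i 1) =
      4 * c ^ 2 * ((z - x) i) ^ 2 * deriv (deriv θ) (c * ‖z - x‖ ^ 2) +
        2 * c * deriv θ (c * ‖z - x‖ ^ 2) := by
    intro i
    simp_rw [fderiv_radial hD]
    have h1 : HasFDerivAt (fun y => deriv θ (c * ‖y - x‖ ^ 2))
        (fderiv ℝ (fun y => deriv θ (c * ‖y - x‖ ^ 2)) z) z := by
      refine DifferentiableAt.hasFDerivAt ?_
      refine hD'.differentiableAt.comp z ?_
      exact (((differentiableAt_id.sub_const x).norm_sq ℝ).const_mul c)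
    have h2 : HasFDerivAt (fun y : EuclideanSpace ℝ (Fin n) =>
        2 * c * inner ℝ (y - x) (EuclideanSpace.single i (1 : ℝ)))
        ((2 * c) • innerSL ℝ (EuclideanSpace.single i (1 : ℝ))) z := by
      have : HasFDerivAt (fun y : EuclideanSpace ℝ (Fin n) =>
          (innerSL ℝ (EuclideanSpace.single i (1 : ℝ))) (y - x))
          ((innerSL ℝ (EuclideanSpace.single i (1 : ℝ))).comp (ContinuousLinearMap.id ℝ _)) z :=
        (innerSL ℝ (EuclideanSpace.single i (1 : ℝ))).hasFDerivAt.comp z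
          ((hasFDerivAt_id z).sub_const x)
      have h4 := this.const_mul (2 * c)
      simp only [ContinuousLinearMap.comp_id] at h4
      refine h4.congr_of_eventuallyEq (.of_forall fun y => ?_)
      simp only [innerSL_apply_apply]
      rw [real_inner_comm]
    have h5 : HasFDerivAt (fun y => deriv θ (c * ‖y - x‖ ^ 2) *
        (2 * c * inner ℝ (y - x) (EuclideanSpace.single i (1 : ℝ)))) _ z := h1.mul h2
    rw [h5.fderiv]
    simp [fderiv_radial hD', EuclideanSpace.inner_single_right]
    ring
  rw [lap]
  simp_rw [hi]
  rw [Finset.sum_add_distrib, ← Finset.sum_mul, ← Finset.mul_sum, EuclideanSpace.norm_sq_eq]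
  simp
  ring

theorem lap_bump (r : ℝ) (x z : EuclideanSpace ℝ (Fin n)) :
    lap (k.bump r x) z = r * r⁻¹ ^ n * (4 * (r⁻¹ ^ 2) ^ 2 * ‖z - x‖ ^ 2 *
      deriv (deriv k.κ) (r⁻¹ ^ 2 * ‖z - x‖ ^ 2) +
        2 * n * r⁻¹ ^ 2 * deriv k.κ (r⁻¹ ^ 2 * ‖z - x‖ ^ 2)) := by
  have h := lap_radial (contDiff_const.mul k.contDiff : ContDiff ℝ ∞ fun s => r * r⁻¹ ^ n * k.κ s)
    (r⁻¹ ^ 2) x z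
  have hd : deriv (fun s => r * r⁻¹ ^ n * k.κ s) = fun s => r * r⁻¹ ^ n * deriv k.κ s := by
    ext1 s
    exact deriv_const_mul _ ((k.contDiff.differentiable (by simp)) s)
  have hd' : deriv (fun s => r * r⁻¹ ^ n * deriv k.κ s) =
      fun s => r * r⁻¹ ^ n * deriv (deriv k.κ) s := by
    ext1 s
    exact deriv_const_mul _ ((k.contDiff_deriv.differentiable (by simp)) s)
  rw [hd, hd'] at h
  refine Eq.trans h ?_
  ring

/-- With `q = |z - x|²/r²`, both sides equal `r⁻¹ r⁻ⁿ (4q κ''(q) + 2n κ'(q))`. This identity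
dictates the form `-2κ'(|y|²)` of the density: it turns sign conditions on the distributional
Laplacian into monotonicity of averages in the radius. -/
theorem hasDerivAt_kernel {r : ℝ} (hr : 0 < r) (x z : EuclideanSpace ℝ (Fin n)) :
    HasDerivAt (fun r : ℝ => r⁻¹ ^ n * k.η (r⁻¹ • (z - x))) (lap (k.bump r x) z) r := by
  have hη : ∀ r : ℝ, k.η (r⁻¹ • (z - x)) = -2 * deriv k.κ (r⁻¹ ^ 2 * ‖z - x‖ ^ 2) := by
    intro r
    rw [η, norm_smul, mul_pow, Real.norm_eq_abs, sq_abs]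
  simp_rw [hη]
  have h1 : HasDerivAt (fun r : ℝ => r⁻¹) (-(r ^ 2)⁻¹) r := hasDerivAt_inv hr.ne'
  have h2 := h1.pow n
  have h3 := (h1.pow 2).mul_const (‖z - x‖ ^ 2)
  have h4 := ((k.contDiff_deriv.differentiable (by simp)) (r⁻¹ ^ 2 * ‖z - x‖ ^ 2)).hasDerivAt.comp r h3
  refine (h2.mul (h4.const_mul (-2))).congr_deriv ?_
  rw [lap_bump]
  -- Differentiating `r⁻¹ ^ n` produces the exponent `n - 1`, truncated when `n = 0`.
  rcases n with _ | m
  · simp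
    field_simp
    ring
  · simp
    field_simp
    ring

/-- Up to the scaling factor the Laplacian is a fixed continuous function of `q = |z - x|²/r²`,
vanishing for `q > 1`. The bound dominates the radius derivative under the integral sign. -/
theorem exists_abs_lap_bump_le : ∃ M : ℝ, 0 < M ∧ ∀ r : ℝ, 0 < r → ∀ x z : EuclideanSpace ℝ (Fin n),
    |lap (k.bump r x) z| ≤ r⁻¹ * r⁻¹ ^ n * M := by
  have hc : Continuous fun q : ℝ => 4 * q * deriv (deriv k.κ) q + 2 * n * deriv k.κ q :=
    ((continuous_const.mul continuous_id).mul k.contDiff_deriv_deriv.continuous).add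
      (continuous_const.mul k.contDiff_deriv.continuous)
  obtain ⟨M, hM⟩ := (isCompact_Icc (a := (0 : ℝ)) (b := 1)).exists_bound_of_continuousOn
    hc.continuousOn
  refine ⟨max M 1, by positivity, fun r hr x z => ?_⟩
  have hq : |4 * (r⁻¹ ^ 2 * ‖z - x‖ ^ 2) * deriv (deriv k.κ) (r⁻¹ ^ 2 * ‖z - x‖ ^ 2) +
      2 * n * deriv k.κ (r⁻¹ ^ 2 * ‖z - x‖ ^ 2)| ≤ max M 1 := by
    by_cases h : r⁻¹ ^ 2 * ‖z - x‖ ^ 2 ≤ 1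
    · exact (hM _ ⟨by positivity, h⟩).trans (le_max_left _ _)
    · rw [not_le] at h
      rw [k.deriv_eq_zero h, k.deriv_deriv_eq_zero h]
      simp
  have : lap (k.bump r x) z = r⁻¹ * r⁻¹ ^ n * (4 * (r⁻¹ ^ 2 * ‖z - x‖ ^ 2) *
      deriv (deriv k.κ) (r⁻¹ ^ 2 * ‖z - x‖ ^ 2) +
      2 * n * deriv k.κ (r⁻¹ ^ 2 * ‖z - x‖ ^ 2)) := by
    rw [lap_bump]
    field_simp
  rw [this, abs_mul, abs_of_pos (by positivity : 0 < r⁻¹ * r⁻¹ ^ n)]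
  gcongr

theorem continuous_kernel (r : ℝ) : Continuous fun y : EuclideanSpace ℝ (Fin n) =>
    r⁻¹ ^ n * k.η (r⁻¹ • y) :=
  continuous_const.mul (k.contDiff_η.continuous.comp (continuous_const_smul _))

theorem integrable_mul_kernel {U : EuclideanSpace ℝ (Fin n) → ℝ} (hU : Integrable U) (r : ℝ)
    (x : EuclideanSpace ℝ (Fin n)) :
    Integrable fun z => U z * (r⁻¹ ^ n * k.η (r⁻¹ • (z - x))) := by
  obtain ⟨M, -, hM⟩ := k.exists_η_le
  refine hU.mul_bdd (c := |r⁻¹ ^ n| * M)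
    ((k.continuous_kernel r).comp (continuous_sub_right x)).aestronglyMeasurable
    (.of_forall fun z => ?_)
  rw [Real.norm_eq_abs, abs_mul, abs_of_nonneg (k.η_nonneg _)]
  exact mul_le_mul_of_nonneg_left (hM _) (abs_nonneg _)

theorem hasDerivAt_avg {U : EuclideanSpace ℝ (Fin n) → ℝ} (hU : Integrable U) {r : ℝ} (hr : 0 < r)
    (x : EuclideanSpace ℝ (Fin n)) :
    HasDerivAt (fun r => k.avg r U x) (∫ z, U z * lap (k.bump r x) z) r := by
  obtain ⟨M, hM0, hM⟩ := k.exists_abs_lap_bump_le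
  have hpos : ∀ s ∈ Metric.ball r (r / 2), r / 2 < s := by
    intro s hs
    rw [Metric.mem_ball, Real.dist_eq, abs_lt] at hs
    linarith
  refine (hasDerivAt_integral_of_dominated_loc_of_deriv_le (μ := volume)
    (F := fun s z => U z * (s⁻¹ ^ n * k.η (s⁻¹ • (z - x))))
    (F' := fun s z => U z * lap (k.bump s x) z)
    (bound := fun z => |U z| * ((r / 2)⁻¹ * (r / 2)⁻¹ ^ n * M)) (Metric.ball_mem_nhds r (half_pos hr))
    (.of_forall fun s => (k.integrable_mul_kernel hU s x).aestronglyMeasurable)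
    (k.integrable_mul_kernel hU r x)
    (hU.aestronglyMeasurable.mul (continuous_lap (k.contDiff_bump r x)).aestronglyMeasurable)
    (.of_forall fun z s hs => ?_) (hU.abs.mul_const _) (.of_forall fun z s hs => ?_)).2
  · have hs' := hpos s hs
    have hs0 : 0 < s := (half_pos hr).trans hs'
    rw [norm_mul, Real.norm_eq_abs, Real.norm_eq_abs]
    refine mul_le_mul_of_nonneg_left ((hM s hs0 x z).trans ?_) (abs_nonneg _)
    have : s⁻¹ ≤ (r / 2)⁻¹ := inv_anti₀ (half_pos hr) hs'.le
    gcongr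
  · exact (k.hasDerivAt_kernel ((half_pos hr).trans (hpos s hs)) x z).const_mul _

theorem integral_scaled (r : ℝ) (hr : 0 < r) (θ : EuclideanSpace ℝ (Fin n) → ℝ)
    (x : EuclideanSpace ℝ (Fin n)) :
    ∫ z, r⁻¹ ^ n * θ (r⁻¹ • (z - x)) = ∫ y, θ y := by
  rw [integral_const_mul, integral_sub_right_eq_self (fun z => θ (r⁻¹ • z)) x,
    Measure.integral_comp_inv_smul_of_nonneg volume θ hr.le]
  simp only [finrank_euclideanSpace, Fintype.card_fin, smul_eq_mul]
  rw [← mul_assoc, ← mul_pow, inv_mul_cancel₀ hr.ne', one_pow, one_mul]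

theorem integral_kernel {r : ℝ} (hr : 0 < r) (x : EuclideanSpace ℝ (Fin n)) :
    ∫ z, r⁻¹ ^ n * k.η (r⁻¹ • (z - x)) = 1 := by
  rw [integral_scaled r hr, k.integral_η]

theorem integral_bump {r : ℝ} (hr : 0 < r) (x : EuclideanSpace ℝ (Fin n)) :
    ∫ z, k.bump r x z = r * ∫ y : EuclideanSpace ℝ (Fin n), k.κ (‖y‖ ^ 2) := by
  rw [← integral_scaled r hr (fun y => k.κ (‖y‖ ^ 2)) x, ← integral_const_mul]
  refine integral_congr_ae (.of_forall fun z => ?_)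
  simp only [bump, norm_smul, mul_pow, Real.norm_eq_abs, sq_abs]
  ring

end RadialKernel

end RadialKernel

/-! ### Monotone averages and the continuous representative. -/

section Representative

variable {n : ℕ} {Ω : Set (EuclideanSpace ℝ (Fin n))}

/-- `-C ≤ ΔU ≤ 0` in `Ω`, in the sense of distributions. -/
structure WeakLapBounds (Ω : Set (EuclideanSpace ℝ (Fin n))) (U : EuclideanSpace ℝ (Fin n) → ℝ)
    (C : ℝ) : Prop where
  integrable : Integrable U
  const_nonneg : 0 ≤ C
  nonpos : ∀ ψ : EuclideanSpace ℝ (Fin n) → ℝ, ContDiff ℝ ∞ ψ → HasCompactSupport ψ →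
    tsupport ψ ⊆ Ω → (∀ x, 0 ≤ ψ x) → ∫ x, U x * lap ψ x ≤ 0
  ge : ∀ ψ : EuclideanSpace ℝ (Fin n) → ℝ, ContDiff ℝ ∞ ψ → HasCompactSupport ψ →
    tsupport ψ ⊆ Ω → (∀ x, 0 ≤ ψ x) → -(C * ∫ x, ψ x) ≤ ∫ x, U x * lap ψ x

namespace RadialKernel

variable (k : RadialKernel n)

/-- The constant of the mean value inequality. -/
noncomputable def mass : ℝ := ∫ y : EuclideanSpace ℝ (Fin n), k.κ (‖y‖ ^ 2)

theorem mass_nonneg : 0 ≤ k.mass := integral_nonneg fun _ => k.nonneg _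

theorem continuous_avg {U : EuclideanSpace ℝ (Fin n) → ℝ} (hU : Integrable U) (r : ℝ) :
    Continuous (k.avg r U) := by
  obtain ⟨M, -, hM⟩ := k.exists_η_le
  refine continuous_of_dominated (bound := fun z => |U z| * (|r⁻¹ ^ n| * M))
    (fun x => (k.integrable_mul_kernel hU r x).aestronglyMeasurable)
    (fun x => .of_forall fun z => ?_) (hU.abs.mul_const _) (.of_forall fun z => ?_)
  · rw [Real.norm_eq_abs, abs_mul, abs_mul, abs_of_nonneg (k.η_nonneg _)]
    exact mul_le_mul_of_nonneg_left (mul_le_mul_of_nonneg_left (hM _) (abs_nonneg _))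
      (abs_nonneg _)
  · exact continuous_const.mul ((k.continuous_kernel r).comp (continuous_sub_left z))

/-- By the mean value theorem in the radius, the slope of the average is `∫ U Δ(bump)` at some
intermediate `t`. The weak bounds put it between `-C·mass·t` and `0`, since the bump has integral
`t·mass`. -/
theorem avg_mem_of_lt {U : EuclideanSpace ℝ (Fin n) → ℝ} {C : ℝ} (hU : WeakLapBounds Ω U C)
    {x : EuclideanSpace ℝ (Fin n)} {s r : ℝ} (hs : 0 < s) (hsr : s < r)
    (hx : Metric.closedBall x r ⊆ Ω) :
    k.avg r U x ≤ k.avg s U x ∧ k.avg s U x ≤ k.avg r U x + C * k.mass * r ^ 2 := by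
  have hder : ∀ t ∈ Set.Ioo s r, HasDerivAt (fun r => k.avg r U x)
      (∫ z, U z * lap (k.bump t x) z) t := fun t ht =>
    k.hasDerivAt_avg hU.integrable (hs.trans ht.1) x
  have hcont : ContinuousOn (fun r => k.avg r U x) (Set.Icc s r) := fun t ht =>
    (k.hasDerivAt_avg hU.integrable (hs.trans_le ht.1) x).continuousAt.continuousWithinAt
  obtain ⟨t, ht, he⟩ := exists_hasDerivAt_eq_slope _ _ hsr hcont hder
  have ht0 := hs.trans ht.1
  have hsupp : tsupport (k.bump t x) ⊆ Ω := (k.tsupport_bump_subset ht0 x).trans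
    ((Metric.closedBall_subset_closedBall ht.2.le).trans hx)
  have h1 := hU.nonpos _ (k.contDiff_bump t x) (k.hasCompactSupport_bump ht0 x) hsupp
    (k.bump_nonneg ht0 x)
  have h2 := hU.ge _ (k.contDiff_bump t x) (k.hasCompactSupport_bump ht0 x) hsupp
    (k.bump_nonneg ht0 x)
  rw [k.integral_bump ht0, ← mass] at h2
  have hrs : 0 < r - s := sub_pos.2 hsr
  rw [he] at h1 h2
  rw [div_le_iff₀ hrs, zero_mul] at h1
  rw [le_div_iff₀ hrs] at h2
  refine ⟨by linarith, ?_⟩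
  have hI := k.mass_nonneg
  have hCI : 0 ≤ C * k.mass := mul_nonneg hU.const_nonneg hI
  have h3 : t * (r - s) ≤ r * r :=
    mul_le_mul ht.2.le (by linarith) hrs.le (by linarith)
  nlinarith [mul_le_mul_of_nonneg_left h3 hCI]

/-- As the radius shrinks the averages increase and remain bounded, hence converge. The value chosen
outside `Ω` is irrelevant. -/
theorem exists_representative (hΩo : IsOpen Ω) {U : EuclideanSpace ℝ (Fin n) → ℝ} {C : ℝ}
    (hU : WeakLapBounds Ω U C) : ∃ v : EuclideanSpace ℝ (Fin n) → ℝ,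
      ∀ x ∈ Ω, Tendsto (fun r => k.avg r U x) (𝓝[>] 0) (𝓝 (v x)) := by
  have : ∀ x : EuclideanSpace ℝ (Fin n), ∃ l : ℝ, x ∈ Ω →
      Tendsto (fun r => k.avg r U x) (𝓝[>] 0) (𝓝 l) := by
    intro x
    by_cases hx : x ∈ Ω
    · obtain ⟨R, hR, hRΩ⟩ := Metric.nhds_basis_closedBall.mem_iff.1 (hΩo.mem_nhds hx)
      refine ⟨_, fun _ => AntitoneOn.tendsto_nhdsWithin_Ioo_right (y := R)
        (Set.nonempty_Ioo.2 hR) (fun s hs r hr hsr => ?_) ⟨k.avg R U x + C * k.mass * R ^ 2, ?_⟩⟩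
      · rcases hsr.eq_or_lt with rfl | h
        · exact le_rfl
        · exact (k.avg_mem_of_lt hU hs.1 h
            ((Metric.closedBall_subset_closedBall hr.2.le).trans hRΩ)).1
      · rintro _ ⟨s, hs, rfl⟩
        exact (k.avg_mem_of_lt hU hs.1 hs.2 hRΩ).2
    · exact ⟨0, fun h => (hx h).elim⟩
  choose v hv using this
  exact ⟨v, hv⟩

variable {U v : EuclideanSpace ℝ (Fin n) → ℝ} {C : ℝ}

theorem avg_le_representative (hU : WeakLapBounds Ω U C) {x : EuclideanSpace ℝ (Fin n)}
    (hv : Tendsto (fun r => k.avg r U x) (𝓝[>] 0) (𝓝 (v x))) {r : ℝ} (hr : 0 < r)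
    (hx : Metric.closedBall x r ⊆ Ω) : k.avg r U x ≤ v x := by
  refine ge_of_tendsto hv ?_
  filter_upwards [Ioo_mem_nhdsGT hr] with s hs using (k.avg_mem_of_lt hU hs.1 hs.2 hx).1

theorem representative_le_avg (hU : WeakLapBounds Ω U C) {x : EuclideanSpace ℝ (Fin n)}
    (hv : Tendsto (fun r => k.avg r U x) (𝓝[>] 0) (𝓝 (v x))) {r : ℝ} (hr : 0 < r)
    (hx : Metric.closedBall x r ⊆ Ω) : v x ≤ k.avg r U x + C * k.mass * r ^ 2 := by
  refine le_of_tendsto hv ?_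
  filter_upwards [Ioo_mem_nhdsGT hr] with s hs using (k.avg_mem_of_lt hU hs.1 hs.2 hx).2

theorem avg_eq_representative (hU : Integrable U) {x : EuclideanSpace ℝ (Fin n)}
    (hv : Tendsto (fun r => k.avg r U x) (𝓝[>] 0) (𝓝 (v x))) {r : ℝ} (hr : 0 < r)
    (h0 : ∀ t, 0 < t → t ≤ r → ∫ z, U z * lap (k.bump t x) z = 0) : k.avg r U x = v x := by
  refine tendsto_nhds_unique (tendsto_const_nhds.congr' ?_) hv
  filter_upwards [Ioo_mem_nhdsGT hr] with s hs
  have hder : ∀ t ∈ Set.Ioo s r, HasDerivAt (fun r => k.avg r U x)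
      (∫ z, U z * lap (k.bump t x) z) t := fun t ht =>
    k.hasDerivAt_avg hU (hs.1.trans ht.1) x
  have hcont : ContinuousOn (fun r => k.avg r U x) (Set.Icc s r) := fun t ht =>
    (k.hasDerivAt_avg hU (hs.1.trans_le ht.1) x).continuousAt.continuousWithinAt
  obtain ⟨t, ht, he⟩ := exists_hasDerivAt_eq_slope _ _ hs.2 hcont hder
  rw [h0 t (hs.1.trans ht.1) ht.2.le, eq_comm, div_eq_zero_iff] at he
  rcases he with he | he
  · linarith
  · linarith [hs.2]

/-- Locally, `v` differs from the continuous average at scale `r` by at most `C·mass·r²`, so it is a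
locally uniform limit of continuous functions. -/
theorem continuousOn_representative (hΩo : IsOpen Ω) (hU : WeakLapBounds Ω U C)
    (hv : ∀ x ∈ Ω, Tendsto (fun r => k.avg r U x) (𝓝[>] 0) (𝓝 (v x))) : ContinuousOn v Ω := by
  intro x hx
  refine ContinuousAt.continuousWithinAt ?_
  obtain ⟨R, hR, hRΩ⟩ := Metric.nhds_basis_closedBall.mem_iff.1 (hΩo.mem_nhds hx)
  rw [Metric.continuousAt_iff']
  intro ε hε
  have hA : 0 ≤ C * k.mass := mul_nonneg hU.const_nonneg k.mass_nonneg
  obtain ⟨r, hr0, hrR, hrε⟩ : ∃ r, 0 < r ∧ r < R / 2 ∧ C * k.mass * r ^ 2 < ε / 3 := by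
    have ht : Tendsto (fun r : ℝ => C * k.mass * r ^ 2) (𝓝[>] 0) (𝓝 0) := by
      have : Continuous fun r : ℝ => C * k.mass * r ^ 2 := by fun_prop
      simpa using (this.tendsto 0).mono_left nhdsWithin_le_nhds
    obtain ⟨r, h1, h2⟩ := ((ht.eventually (gt_mem_nhds (by positivity : (0 : ℝ) < ε / 3))).and
      (Ioo_mem_nhdsGT (half_pos hR))).exists
    exact ⟨r, h2.1, h2.2, h1⟩
  have hcont := Metric.continuousAt_iff'.1
    ((k.continuous_avg hU.integrable r).continuousAt (x := x)) (ε / 3) (by positivity)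
  filter_upwards [hcont, Metric.ball_mem_nhds x (half_pos hR)] with y hy hyR
  have hyΩ : Metric.closedBall y r ⊆ Ω :=
    (Metric.closedBall_subset_closedBall' (by linarith [Metric.mem_ball.1 hyR])).trans hRΩ
  have hxΩ : Metric.closedBall x r ⊆ Ω :=
    (Metric.closedBall_subset_closedBall (by linarith)).trans hRΩ
  have hvy := hv y (hyΩ (Metric.mem_closedBall_self hr0.le))
  have a1 := k.avg_le_representative hU hvy hr0 hyΩ
  have a2 := k.representative_le_avg hU hvy hr0 hyΩ
  have a3 := k.avg_le_representative hU (hv x hx) hr0 hxΩ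
  have a4 := k.representative_le_avg hU (hv x hx) hr0 hxΩ
  rw [Real.dist_eq, abs_lt] at hy ⊢
  constructor <;> linarith

/-- The kernels have integral one, live on the balls of radius `r`, and are bounded by a multiple of
the inverse volume. Lebesgue's differentiation theorem therefore identifies their limit. -/
theorem representative_ae_eq (hΩo : IsOpen Ω) (hU : Integrable U)
    (hv : ∀ x ∈ Ω, Tendsto (fun r => k.avg r U x) (𝓝[>] 0) (𝓝 (v x))) :
    ∀ᵐ x ∂(volume.restrict Ω), v x = U x := by
  obtain ⟨M, hM0, hM⟩ := k.exists_η_le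
  refine (ae_restrict_iff' hΩo.measurableSet).2 ?_
  filter_upwards [(Besicovitch.vitaliFamily volume).ae_tendsto_average_norm_sub
    hU.locallyIntegrable] with x h hx
  refine tendsto_nhds_unique (hv x hx) ?_
  have h' := h.comp (Besicovitch.tendsto_filterAt volume x)
  have := tendsto_integral_smul_of_tendsto_average_norm_sub (μ := volume)
    (g := fun r z => r⁻¹ ^ n * k.η (r⁻¹ • (z - x)))
    (M * volume.real (Metric.ball (0 : EuclideanSpace ℝ (Fin n)) 1)) h'
    (.of_forall fun r => hU.integrableOn) ?_ ?_ ?_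
  · refine this.congr fun r => ?_
    rw [avg]
    simp_rw [smul_eq_mul, mul_comm (U _)]
  · refine tendsto_const_nhds.congr' ?_
    filter_upwards [self_mem_nhdsWithin] with r hr using (k.integral_kernel hr x).symm
  · filter_upwards [self_mem_nhdsWithin] with r hr z hz
    by_contra hzr
    rw [Metric.mem_closedBall, not_le] at hzr
    exact hz (by simp [k.η_scaled_eq_zero hr hzr])
  · filter_upwards [self_mem_nhdsWithin] with r hr z
    have hr : 0 < r := hr
    rw [Measure.addHaar_real_closedBall volume x hr.le, abs_of_nonneg
      (mul_nonneg (by positivity) (k.η_nonneg _)), finrank_euclideanSpace, Fintype.card_fin]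
    have hb : 0 < volume.real (Metric.ball (0 : EuclideanSpace ℝ (Fin n)) 1) :=
      ENNReal.toReal_pos (Metric.measure_ball_pos _ _ one_pos).ne' measure_ball_lt_top.ne
    rw [mul_div_mul_right _ _ hb.ne', div_eq_inv_mul, inv_pow]
    exact mul_le_mul_of_nonneg_left (hM _) (by positivity)

end RadialKernel

end Representative

/-! ### Quadratic growth at contact points. -/

section Growth

variable {n : ℕ} {Ω : Set (EuclideanSpace ℝ (Fin n))}

theorem abs_sub_sub_fderiv_le {g : EuclideanSpace ℝ (Fin n) → ℝ}
    {S : Set (EuclideanSpace ℝ (Fin n))} {L : ℝ≥0} (hg : ∀ z ∈ S, DifferentiableAt ℝ g z)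
    (hL : LipschitzOnWith L (fderiv ℝ g) S) {x y : EuclideanSpace ℝ (Fin n)}
    (hxy : segment ℝ x y ⊆ S) :
    |g y - g x - fderiv ℝ g x (y - x)| ≤ L * ‖y - x‖ ^ 2 := by
  have h := (convex_segment x y).norm_image_sub_le_of_norm_hasFDerivWithin_le'
    (f := g) (f' := fderiv ℝ g) (φ := fderiv ℝ g x) (C := L * ‖y - x‖)
    (fun z hz => (hg z (hxy hz)).hasFDerivAt.hasFDerivWithinAt) (fun z hz => ?_)
    (left_mem_segment ℝ x y) (right_mem_segment ℝ x y)
  · rw [Real.norm_eq_abs] at h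
    linarith [h, sq ‖y - x‖]
  · have h1 := hL.dist_le_mul z (hxy hz) x (hxy (left_mem_segment ℝ x y))
    rw [dist_eq_norm, dist_eq_norm] at h1
    refine h1.trans (mul_le_mul_of_nonneg_left ?_ L.coe_nonneg)
    obtain ⟨t, ht, rfl⟩ := (segment_eq_image' ℝ x y) ▸ hz
    simp only [add_sub_cancel_left, norm_smul, Real.norm_eq_abs, abs_of_nonneg ht.1]
    exact mul_le_of_le_one_left (norm_nonneg _) ht.2

namespace RadialKernel

variable (k : RadialKernel n)

theorem hasCompactSupport_kernel {r : ℝ} (hr : 0 < r) (x : EuclideanSpace ℝ (Fin n)) :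
    HasCompactSupport fun z => r⁻¹ ^ n * k.η (r⁻¹ • (z - x)) :=
  HasCompactSupport.intro (isCompact_closedBall x r) fun z hz => by
    rw [Metric.mem_closedBall, not_le] at hz
    rw [k.η_scaled_eq_zero hr hz, mul_zero]

theorem integrable_continuous_mul_kernel {r : ℝ} (hr : 0 < r) (x : EuclideanSpace ℝ (Fin n))
    {θ : EuclideanSpace ℝ (Fin n) → ℝ} (hθ : Continuous θ) :
    Integrable fun z => θ z * (r⁻¹ ^ n * k.η (r⁻¹ • (z - x))) :=
  (hθ.mul ((k.continuous_kernel r).comp (continuous_sub_right x))).integrable_of_hasCompactSupport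
    (k.hasCompactSupport_kernel hr x).mul_left

/-- The kernel is even about its centre and has integral one, so the linear part about that centre
averages to zero. -/
theorem avg_affine {r : ℝ} (hr : 0 < r) (a : ℝ) (p : EuclideanSpace ℝ (Fin n) →L[ℝ] ℝ)
    (x y : EuclideanSpace ℝ (Fin n)) : k.avg r (fun z => a + p (z - x)) y = a + p (y - x) := by
  have h1 : ∀ z, (a + p (z - x)) * (r⁻¹ ^ n * k.η (r⁻¹ • (z - y))) =
      (a + p (y - x)) * (r⁻¹ ^ n * k.η (r⁻¹ • (z - y))) +
        p (z - y) * (r⁻¹ ^ n * k.η (r⁻¹ • (z - y))) := by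
    intro z
    rw [← add_mul, add_assoc, ← map_add]
    congr 4
    abel
  have h2 : ∫ z, p (z - y) * (r⁻¹ ^ n * k.η (r⁻¹ • (z - y))) = 0 := by
    rw [integral_sub_right_eq_self (fun z => p z * (r⁻¹ ^ n * k.η (r⁻¹ • z))) y]
    have := integral_neg_eq_self (fun z => p z * (r⁻¹ ^ n * k.η (r⁻¹ • z))) volume
    simp only [map_neg, smul_neg, k.η_neg, neg_mul, integral_neg] at this
    linarith
  rw [avg]
  simp_rw [h1]
  have hpc : Continuous fun z => p (z - y) := p.continuous.comp (continuous_sub_right y)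
  rw [integral_add (k.integrable_continuous_mul_kernel hr y continuous_const)
    (k.integrable_continuous_mul_kernel hr y hpc), h2, integral_const_mul, k.integral_kernel hr, mul_one, add_zero]

/-- This replaces Harnack's inequality. Where the smaller kernel is nonzero, `|z - x| ≤ r/4 + r/4 =
r/2`; there the squared rescaled norm is at most `1/4`, the range on which `κ'` is bounded away from
zero. -/
theorem exists_kernel_le : ∃ c : ℝ, 0 ≤ c ∧ ∀ r : ℝ, 0 < r → ∀ x y z : EuclideanSpace ℝ (Fin n),
    dist y x ≤ r / 4 → (r / 4)⁻¹ ^ n * k.η ((r / 4)⁻¹ • (z - y)) ≤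
      c * (r⁻¹ ^ n * k.η (r⁻¹ • (z - x))) := by
  obtain ⟨M, hM0, hM⟩ := k.exists_η_le
  obtain ⟨c, hc, hcη⟩ := k.deriv_neg
  refine ⟨4 ^ n * (M / (2 * c)), by positivity, fun r hr x y z hyx => ?_⟩
  rcases lt_or_ge (r / 4) (dist z y) with h | h
  · rw [k.η_scaled_eq_zero (by positivity) h, mul_zero]
    have := k.η_nonneg (r⁻¹ • (z - x))
    positivity
  · have hzx : ‖z - x‖ ≤ r / 2 := by
      rw [← dist_eq_norm]
      linarith [dist_triangle z y x]
    have hη : 2 * c ≤ k.η (r⁻¹ • (z - x)) := by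
      have h1 : ‖r⁻¹ • (z - x)‖ ≤ 1 / 2 := by
        rw [norm_smul, norm_inv, Real.norm_eq_abs, abs_of_pos hr, inv_mul_le_iff₀ hr]
        linarith
      have := hcη (‖r⁻¹ • (z - x)‖ ^ 2) (by nlinarith [norm_nonneg (r⁻¹ • (z - x))])
        (by positivity)
      rw [η]
      linarith
    have h2 : (r / 4)⁻¹ ^ n = 4 ^ n * r⁻¹ ^ n := by
      rw [← mul_pow, inv_div, div_eq_mul_inv]
    rw [h2]
    have h3 : M ≤ M / (2 * c) * k.η (r⁻¹ • (z - x)) := by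
      rw [div_mul_eq_mul_div, le_div_iff₀ (by positivity)]
      exact mul_le_mul_of_nonneg_left hη hM0.le
    calc 4 ^ n * r⁻¹ ^ n * k.η ((r / 4)⁻¹ • (z - y))
        ≤ 4 ^ n * r⁻¹ ^ n * (M / (2 * c) * k.η (r⁻¹ • (z - x))) :=
          mul_le_mul_of_nonneg_left ((hM _).trans h3) (by positivity)
      _ = _ := by ring

/-- Averages of bounded functions have quadratic expansions. -/
theorem exists_expansion : ∃ B : ℝ, 0 ≤ B ∧ ∀ r : ℝ, 0 < r → ∀ (x : EuclideanSpace ℝ (Fin n))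
    (V : EuclideanSpace ℝ (Fin n) → ℝ) (N : ℝ), 0 ≤ N → Integrable V →
    (∀ᵐ z ∂(volume.restrict (Metric.ball x (2 * r))), |V z| ≤ N) →
    (∀ z, z ∉ Metric.ball x (2 * r) → V z = 0) →
    ∃ p : EuclideanSpace ℝ (Fin n) →L[ℝ] ℝ, ‖p‖ ≤ B * N / r ∧
      ∀ y, |k.avg r V y - k.avg r V x - p (y - x)| ≤ B * N / r ^ 2 * ‖y - x‖ ^ 2 := by
  have hη := k.contDiff_η
  have hη' : ContDiff ℝ 1 (fderiv ℝ k.η) := (hη.fderiv_right (m := ∞) (by simp)).of_le (by simp)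
  have hηc := k.hasCompactSupport_η.fderiv (𝕜 := ℝ)
  obtain ⟨B₁, hB₁⟩ := hηc.exists_bound_of_continuous hη'.continuous
  obtain ⟨B₂, hB₂⟩ := hη'.lipschitzWith_of_hasCompactSupport hηc one_ne_zero
  have hB₁0 : 0 ≤ B₁ := (norm_nonneg _).trans (hB₁ 0)
  -- `r ^ n * τ` is the volume of the ball of radius `2r` that carries `V`.
  set τ : ℝ := 2 ^ n * volume.real (Metric.ball (0 : EuclideanSpace ℝ (Fin n)) 1) with hτ
  have hτ0 : 0 ≤ τ := by positivity
  refine ⟨(B₁ + B₂) * τ, by positivity, fun r hr x V N hN hV hVN hV0 => ?_⟩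
  have hvol : volume.real (Metric.ball x (2 * r)) = r ^ n * τ := by
    rw [measureReal_def, Measure.addHaar_ball_of_pos volume x (by positivity), ENNReal.toReal_mul,
      ENNReal.toReal_ofReal (by positivity), finrank_euclideanSpace, Fintype.card_fin, mul_pow, hτ,
      measureReal_def]
    ring
  have key : ∀ {F : Type} [NormedAddCommGroup F] [NormedSpace ℝ F]
      (T : EuclideanSpace ℝ (Fin n) → F) (B : ℝ), 0 ≤ B → (∀ z, ‖T z‖ ≤ B) →
      ‖∫ z, V z • T z‖ ≤ N * B * (r ^ n * τ) := by
    intro F _ _ T B hB hT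
    rw [← setIntegral_eq_integral_of_forall_compl_eq_zero (s := Metric.ball x (2 * r))
      (fun z hz => by rw [hV0 z hz, zero_smul]), ← hvol]
    refine norm_setIntegral_le_of_norm_le_const_ae measure_ball_lt_top ?_
    filter_upwards [hVN] with z hz
    rw [norm_smul]
    exact mul_le_mul hz (hT z) (norm_nonneg _) hN
  -- The derivative of the kernel with respect to its centre, at `x`. Its integral against `V` is
  -- the linear part `p`; `S` below is the first-order Taylor remainder.
  let T : EuclideanSpace ℝ (Fin n) → EuclideanSpace ℝ (Fin n) →L[ℝ] ℝ :=
    fun z => (r⁻¹ ^ n * -r⁻¹) • fderiv ℝ k.η (r⁻¹ • (z - x))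
  have hTc : Continuous T := (hη'.continuous.comp
    ((continuous_const_smul r⁻¹).comp (continuous_sub_right x))).const_smul (r⁻¹ ^ n * -r⁻¹)
  have hTb : ∀ z, ‖T z‖ ≤ r⁻¹ ^ n * r⁻¹ * B₁ := by
    intro z
    simp only [T]
    rw [norm_smul, Real.norm_eq_abs, abs_mul, abs_neg, abs_of_pos (by positivity : 0 < r⁻¹ ^ n),
      abs_of_pos (by positivity : 0 < r⁻¹)]
    exact mul_le_mul_of_nonneg_left (hB₁ _) (by positivity)
  have hTi : Integrable fun z => V z • T z :=
    hV.smul_bdd (r⁻¹ ^ n * r⁻¹ * B₁) hTc.aestronglyMeasurable (.of_forall hTb)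
  have hrn : r⁻¹ ^ n * r ^ n = 1 := by rw [← mul_pow, inv_mul_cancel₀ hr.ne', one_pow]
  refine ⟨∫ z, V z • T z, ?_, fun y => ?_⟩
  · refine (key T _ (by positivity) hTb).trans ?_
    calc N * (r⁻¹ ^ n * r⁻¹ * B₁) * (r ^ n * τ) = (r⁻¹ ^ n * r ^ n) * (B₁ * τ * N / r) := by
          field_simp
      _ = B₁ * τ * N / r := by rw [hrn, one_mul]
      _ ≤ (B₁ + B₂) * τ * N / r := by
          have : (0 : ℝ) ≤ B₂ := B₂.coe_nonneg
          gcongr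
          linarith
  · rw [ContinuousLinearMap.integral_apply hTi]
    have i1 := k.integrable_mul_kernel hV r y
    have i2 := k.integrable_mul_kernel hV r x
    have i3 : Integrable fun z => (V z • T z) (y - x) :=
      (ContinuousLinearMap.apply ℝ ℝ (y - x)).integrable_comp hTi
    have i12 : Integrable fun z => V z * (r⁻¹ ^ n * k.η (r⁻¹ • (z - y))) -
        V z * (r⁻¹ ^ n * k.η (r⁻¹ • (z - x))) := i1.sub i2
    rw [avg, avg, ← integral_sub i1 i2, ← integral_sub i12 i3]
    let S : EuclideanSpace ℝ (Fin n) → ℝ := fun z => r⁻¹ ^ n * (k.η (r⁻¹ • (z - y)) -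
      k.η (r⁻¹ • (z - x)) - fderiv ℝ k.η (r⁻¹ • (z - x)) (r⁻¹ • (z - y) - r⁻¹ • (z - x)))
    have hS : ∀ z, ‖S z‖ ≤ r⁻¹ ^ n * (B₂ * (r⁻¹ ^ 2 * ‖y - x‖ ^ 2)) := by
      intro z
      have h1 := abs_sub_sub_fderiv_le (S := Set.univ)
        (fun z _ => (hη.differentiable (by simp)) z) (hB₂.lipschitzOnWith (s := Set.univ))
        (Set.subset_univ (segment ℝ (r⁻¹ • (z - x)) (r⁻¹ • (z - y))))
      have h2 : ‖r⁻¹ • (z - y) - r⁻¹ • (z - x)‖ = r⁻¹ * ‖y - x‖ := by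
        rw [← smul_sub, norm_smul, norm_inv, Real.norm_eq_abs, abs_of_pos hr, norm_sub_rev y x]
        congr 2
        abel
      rw [h2, mul_pow] at h1
      simp only [S]
      rw [Real.norm_eq_abs, abs_mul, abs_of_pos (by positivity : 0 < r⁻¹ ^ n)]
      exact mul_le_mul_of_nonneg_left h1 (by positivity)
    have he : ∀ z, V z * (r⁻¹ ^ n * k.η (r⁻¹ • (z - y))) -
        V z * (r⁻¹ ^ n * k.η (r⁻¹ • (z - x))) - (V z • T z) (y - x) = V z • S z := by
      intro z
      have : r⁻¹ • (z - y) - r⁻¹ • (z - x) = -(r⁻¹ • (y - x)) := by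
        rw [← smul_sub, ← smul_neg]
        congr 1
        abel
      simp only [S, T, this, map_neg, map_smul, smul_eq_mul]
      change _ - V z * ((r⁻¹ ^ n * -r⁻¹) * fderiv ℝ k.η (r⁻¹ • (z - x)) (y - x)) = _
      ring
    have hk := key S _ (by positivity) hS
    rw [Real.norm_eq_abs] at hk
    refine (le_of_eq ?_).trans (hk.trans ?_)
    · congr 1
      exact integral_congr_ae (.of_forall he)
    · calc N * (r⁻¹ ^ n * (B₂ * (r⁻¹ ^ 2 * ‖y - x‖ ^ 2))) * (r ^ n * τ)
          = (r⁻¹ ^ n * r ^ n) * (B₂ * τ * N / r ^ 2 * ‖y - x‖ ^ 2) := by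
            field_simp
        _ = B₂ * τ * N / r ^ 2 * ‖y - x‖ ^ 2 := by rw [hrn, one_mul]
        _ ≤ (B₁ + B₂) * τ * N / r ^ 2 * ‖y - x‖ ^ 2 := by
            gcongr
            linarith

/-- At a contact point the minimizer separates at most quadratically from the tangent plane. -/
theorem exists_abs_sub_tangent_le {φ U v : EuclideanSpace ℝ (Fin n) → ℝ} {C : ℝ} {L : ℝ≥0}
    (hΩo : IsOpen Ω) (hφ : ContDiffOn ℝ 1 φ Ω) (hL : LipschitzOnWith L (fderiv ℝ φ) Ω)
    (hU : WeakLapBounds Ω U C) (hφU : ∀ᵐ x ∂(volume.restrict Ω), φ x ≤ U x)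
    (hv : ∀ x ∈ Ω, Tendsto (fun r => k.avg r U x) (𝓝[>] 0) (𝓝 (v x)))
    (hφv : ∀ x ∈ Ω, φ x ≤ v x) :
    ∃ A : ℝ, 0 ≤ A ∧ ∀ x ∈ Ω, v x = φ x → ∀ y, Metric.closedBall x (4 * dist y x) ⊆ Ω →
      |v y - (φ x + fderiv ℝ φ x (y - x))| ≤ A * ‖y - x‖ ^ 2 := by
  obtain ⟨c, hc0, hc⟩ := k.exists_kernel_le
  have hCm : 0 ≤ C * k.mass := mul_nonneg hU.const_nonneg k.mass_nonneg
  -- The factor `16` converts `r²` into `|y - x|²`, as `r = 4|y - x|`. The terms come from the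
  -- kernel comparison, the Taylor error of `φ`, and the defect in the mean value property.
  refine ⟨16 * (c * L + L + C * k.mass), by positivity, fun x hx hvx y hy => ?_⟩
  rcases eq_or_ne y x with rfl | hne
  · simp [hvx]
  have hd : 0 < dist y x := dist_pos.2 hne
  set r := 4 * dist y x with hr
  have hr0 : 0 < r := by positivity
  have hyx : dist y x ≤ r / 4 := by rw [hr]; linarith
  have hφd : ∀ z ∈ Ω, DifferentiableAt ℝ φ z := fun z hz =>
    (hφ.contDiffAt (hΩo.mem_nhds hz)).differentiableAt one_ne_zero
  have hyr : y ∈ Metric.closedBall x r := Metric.mem_closedBall.2 (by linarith)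
  have htay : ∀ z ∈ Metric.closedBall x r,
      |φ z - φ x - fderiv ℝ φ x (z - x)| ≤ L * ‖z - x‖ ^ 2 := fun z hz =>
    abs_sub_sub_fderiv_le hφd hL (((convex_closedBall x r).segment_subset
      (Metric.mem_closedBall_self hr0.le) hz).trans hy)
  set p := fderiv ℝ φ x with hp
  have hyΩ : y ∈ Ω := hy hyr
  have hyb : Metric.closedBall y (r / 4) ⊆ Ω :=
    (Metric.closedBall_subset_closedBall' (by linarith)).trans hy
  have hLn : (0 : ℝ) ≤ L := L.coe_nonneg
  -- comparison of averages of the nonnegative function `U - l + L r²`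
  have hw : ∀ᵐ z, z ∈ Metric.closedBall x r →
      0 ≤ U z - ((φ x - L * r ^ 2) + p (z - x)) := by
    filter_upwards [(ae_restrict_iff' hΩo.measurableSet).1 hφU] with z hz hzr
    have h1 := (abs_le.1 (htay z hzr)).1
    have h2 := hz (hy hzr)
    have h3 : ‖z - x‖ ≤ r := by rwa [← dist_eq_norm]
    have h4 : L * ‖z - x‖ ^ 2 ≤ L * r ^ 2 := by gcongr
    linarith
  have hafc : Continuous fun z => (φ x - L * r ^ 2) + p (z - x) := by fun_prop
  have hsub : ∀ s, 0 < s → ∀ q, k.avg s (fun z => U z - ((φ x - L * r ^ 2) + p (z - x))) q =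
      k.avg s U q - ((φ x - L * r ^ 2) + p (q - x)) := by
    intro s hs q
    rw [← k.avg_affine hs (φ x - L * r ^ 2) p x q, avg, avg, avg, ← integral_sub
      (k.integrable_mul_kernel hU.integrable s q) (k.integrable_continuous_mul_kernel hs q hafc)]
    simp_rw [sub_mul]
  have hint : ∀ s, 0 < s → ∀ q, Integrable fun z =>
      (U z - ((φ x - L * r ^ 2) + p (z - x))) * (s⁻¹ ^ n * k.η (s⁻¹ • (z - q))) := by
    intro s hs q
    simp_rw [sub_mul (U _)]
    exact (k.integrable_mul_kernel hU.integrable s q).sub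
      (k.integrable_continuous_mul_kernel hs q hafc)
  -- The shifted function is nonnegative on the ball of radius `r`, and both kernels vanish outside
  -- it, so comparing the kernels compares the averages.
  have hcomp : k.avg (r / 4) (fun z => U z - ((φ x - L * r ^ 2) + p (z - x))) y ≤
      c * k.avg r (fun z => U z - ((φ x - L * r ^ 2) + p (z - x))) x := by
    rw [avg, avg, ← integral_const_mul]
    refine integral_mono_ae (hint _ (by positivity) y) ((hint r hr0 x).const_mul c) ?_
    filter_upwards [hw] with z hz
    by_cases hzr : z ∈ Metric.closedBall x r
    · have := mul_le_mul_of_nonneg_left (hc r hr0 x y z hyx) (hz hzr)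
      linarith
    · rw [Metric.mem_closedBall, not_le] at hzr
      have h1 : r / 4 < dist z y := by linarith [dist_triangle z y x]
      rw [k.η_scaled_eq_zero hr0 hzr, k.η_scaled_eq_zero (by positivity) h1]
      simp
  rw [hsub _ (by positivity), hsub _ hr0, sub_self, map_zero] at hcomp
  have h1 := k.avg_le_representative hU (hv x hx) hr0 hy
  have h2 := k.representative_le_avg hU (hv y hyΩ) (by positivity) hyb
  have h3 := (abs_le.1 (htay y hyr)).1
  have h4 := hφv y hyΩ
  -- Contact enters here: the average of `U` at `x` is at most `v x = φ x`, so only the shift `L r²`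
  -- survives.
  have h5 : k.avg r U x - (φ x - L * r ^ 2 + 0) ≤ L * r ^ 2 := by linarith
  have h6 := mul_le_mul_of_nonneg_left h5 hc0
  have hyn : ‖y - x‖ = r / 4 := by rw [← dist_eq_norm, hr]; ring
  rw [hyn] at h3 ⊢
  have h7 : C * k.mass * (r / 4) ^ 2 ≤ C * k.mass * r ^ 2 := by
    gcongr
    linarith
  have h8 : 16 * (c * L + L + C * k.mass) * (r / 4) ^ 2 =
      c * (L * r ^ 2) + L * r ^ 2 + C * k.mass * r ^ 2 := by ring
  have h9 : 0 ≤ c * (L * r ^ 2) := by positivity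
  have h10 : 0 ≤ C * k.mass * r ^ 2 := by positivity
  have h11 : L * (r / 4) ^ 2 ≤ L * r ^ 2 := by
    gcongr
    linarith
  rw [h8, abs_le]
  constructor
  · linarith
  · have : (0 : ℝ) ≤ L * r ^ 2 := by positivity
    linarith

end RadialKernel

end Growth

/-! ### Uniform quadratic expansions and `C^{1,1}_loc` regularity. -/

section QuadraticExpansions

variable {n : ℕ} {Ω : Set (EuclideanSpace ℝ (Fin n))}

theorem hasFDerivAt_of_expansion {v : EuclideanSpace ℝ (Fin n) → ℝ} {x : EuclideanSpace ℝ (Fin n)}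
    {p : EuclideanSpace ℝ (Fin n) →L[ℝ] ℝ} {M ρ : ℝ} (hρ : 0 < ρ)
    (h : ∀ y ∈ Metric.ball x ρ, |v y - v x - p (y - x)| ≤ M * ‖y - x‖ ^ 2) :
    HasFDerivAt v p x := by
  rw [hasFDerivAt_iff_isLittleO]
  have h1 : (fun y => v y - v x - p (y - x)) =O[𝓝 x] fun y => ‖y - x‖ ^ 2 := by
    refine Asymptotics.IsBigO.of_bound M ?_
    filter_upwards [Metric.ball_mem_nhds x hρ] with y hy
    rw [Real.norm_eq_abs, norm_pow, norm_norm]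
    exact h y hy
  exact h1.trans_isLittleO (Asymptotics.isLittleO_pow_sub_sub x one_lt_two)

/-- With `d = |x - y|` and a unit vector `e`, evaluate both expansions at `y + d e` and the one at
`x` also at `y`. The values of `v` cancel, and `d (p - q)(e)` is bounded by errors `4Md² + Md² +
Md²`. -/
theorem norm_sub_le_of_expansion {v : EuclideanSpace ℝ (Fin n) → ℝ}
    {x y : EuclideanSpace ℝ (Fin n)} {p q : EuclideanSpace ℝ (Fin n) →L[ℝ] ℝ} {M ρ : ℝ}
    (hx : ∀ z ∈ Metric.ball x ρ, |v z - v x - p (z - x)| ≤ M * ‖z - x‖ ^ 2)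
    (hy : ∀ z ∈ Metric.ball y ρ, |v z - v y - q (z - y)| ≤ M * ‖z - y‖ ^ 2)
    (hM : 0 ≤ M) (hxy : ‖x - y‖ < ρ / 2) : ‖p - q‖ ≤ 6 * M * ‖x - y‖ := by
  rcases eq_or_ne x y with rfl | hne
  · have hρ : 0 < ρ := by
      rw [sub_self, norm_zero] at hxy; linarith
    rw [(hasFDerivAt_of_expansion hρ hx).unique (hasFDerivAt_of_expansion hρ hy)]
    simp
  set d := ‖x - y‖ with hd
  have hd0 : 0 < d := norm_pos_iff.2 (sub_ne_zero.2 hne)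
  refine ContinuousLinearMap.opNorm_le_of_unit_norm (by positivity) fun e he => ?_
  have hw : ‖d • e‖ = d := by rw [norm_smul, he, mul_one, Real.norm_eq_abs, abs_of_pos hd0]
  have hyx : ‖y - x‖ = d := by rw [hd, norm_sub_rev]
  have n1 : ‖y + d • e - x‖ ≤ 2 * d := by
    calc ‖y + d • e - x‖ = ‖(y - x) + d • e‖ := by congr 1; abel
      _ ≤ ‖y - x‖ + ‖d • e‖ := norm_add_le _ _
      _ = 2 * d := by rw [hyx, hw]; ring
  have n2 : ‖y + d • e - y‖ = d := by rw [add_sub_cancel_left, hw]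
  have e1 := hx (y + d • e) (by rw [Metric.mem_ball, dist_eq_norm]; linarith)
  have e2 := hx y (by rw [Metric.mem_ball, dist_eq_norm]; linarith)
  have e3 := hy (y + d • e) (by rw [Metric.mem_ball, dist_eq_norm]; linarith)
  rw [n2] at e3
  rw [hyx] at e2
  have e1' : |v (y + d • e) - v x - p (y + d • e - x)| ≤ M * (2 * d) ^ 2 :=
    e1.trans (by gcongr)
  have l1 : p (y + d • e - x) = p (y - x) + d * p e := by
    rw [← smul_eq_mul, ← map_smul, ← map_add]; congr 1; abel
  have l2 : q (y + d • e - y) = d * q e := by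
    rw [← smul_eq_mul, ← map_smul, add_sub_cancel_left]
  rw [l1] at e1'
  rw [l2] at e3
  have : |d * (p e - q e)| ≤ d * (6 * M * d) := by
    rw [abs_le] at *
    constructor <;> nlinarith
  rw [abs_mul, abs_of_pos hd0] at this
  exact le_of_mul_le_mul_left this hd0

/-- A function with locally uniform quadratic expansions is of class `C^{1,1}_loc`. -/
theorem isC11LocOn_of_expansion (hΩo : IsOpen Ω) {v : EuclideanSpace ℝ (Fin n) → ℝ}
    (h : ∀ K : Set (EuclideanSpace ℝ (Fin n)), IsCompact K → K ⊆ Ω → ∃ M ρ : ℝ, 0 ≤ M ∧ 0 < ρ ∧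
      ∀ x ∈ K, ∃ p : EuclideanSpace ℝ (Fin n) →L[ℝ] ℝ,
        ∀ y ∈ Metric.ball x ρ, |v y - v x - p (y - x)| ≤ M * ‖y - x‖ ^ 2) :
    IsC11LocOn v Ω := by
  have hnear : ∀ K : Set (EuclideanSpace ℝ (Fin n)), IsCompact K → K ⊆ Ω →
      ∃ M ρ : ℝ, 0 ≤ M ∧ 0 < ρ ∧ (∀ x ∈ K, DifferentiableAt ℝ v x) ∧
        ∀ x ∈ K, ∀ y ∈ K, ‖x - y‖ < ρ → ‖fderiv ℝ v x - fderiv ℝ v y‖ ≤ M * ‖x - y‖ := by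
    intro K hK hKΩ
    obtain ⟨M, ρ, hM, hρ, hp⟩ := h K hK hKΩ
    choose! p hp using hp
    have hd := fun x hx => hasFDerivAt_of_expansion hρ (hp x hx)
    refine ⟨6 * M, ρ / 2, by positivity, by positivity, fun x hx => (hd x hx).differentiableAt,
      fun x hx y hy hxy => ?_⟩
    rw [(hd x hx).fderiv, (hd y hy).fderiv]
    exact norm_sub_le_of_expansion (hp x hx) (hp y hy) hM hxy
  have hdiff : DifferentiableOn ℝ v Ω := fun x hx => by
    obtain ⟨_, _, _, _, h1, _⟩ := hnear {x} isCompact_singleton (Set.singleton_subset_iff.2 hx)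
    exact (h1 x rfl).differentiableWithinAt
  have hcont : ContinuousOn (fderiv ℝ v) Ω := fun x hx => by
    obtain ⟨R, hR, hRΩ⟩ := Metric.nhds_basis_closedBall.mem_iff.1 (hΩo.mem_nhds hx)
    obtain ⟨M, ρ, hM, hρ, -, h2⟩ := hnear _ (isCompact_closedBall x R) hRΩ
    refine ContinuousAt.continuousWithinAt ?_
    rw [ContinuousAt, tendsto_iff_norm_sub_tendsto_zero]
    have hlim : Tendsto (fun y => M * ‖y - x‖) (𝓝 x) (𝓝 0) := by
      have : Continuous fun y => M * ‖y - x‖ := by fun_prop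
      simpa using this.tendsto x
    refine squeeze_zero' (.of_forall fun y => norm_nonneg _) ?_ hlim
    filter_upwards [Metric.closedBall_mem_nhds x hR, Metric.ball_mem_nhds x hρ] with y hy hy'
    exact h2 y hy x (Metric.mem_closedBall_self hR.le) (by rwa [← dist_eq_norm])
  refine ⟨?_, fun K hK hKΩ => ?_⟩
  · have := (contDiffOn_succ_iff_fderiv_of_isOpen (𝕜 := ℝ) (n := 0) (f := v) hΩo).2
      ⟨hdiff, by simp, contDiffOn_zero.2 hcont⟩
    simpa using this
  · obtain ⟨M, ρ, hM, hρ, -, h2⟩ := hnear K hK hKΩ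
    obtain ⟨P, hP⟩ := hK.exists_bound_of_continuousOn (hcont.mono hKΩ)
    -- `M` serves pairs closer than `ρ`. For the others, the bound `P` on the derivative gives `2|P|
    -- ≤ (2|P|/ρ) |x - y|`.
    refine ⟨Real.toNNReal (M + 2 * |P| / ρ), LipschitzOnWith.of_dist_le_mul fun x hx y hy => ?_⟩
    rw [dist_eq_norm, dist_eq_norm, Real.coe_toNNReal _ (by positivity)]
    rcases lt_or_ge ‖x - y‖ ρ with hlt | hge
    · refine (h2 x hx y hy hlt).trans (mul_le_mul_of_nonneg_right ?_ (norm_nonneg _))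
      have : 0 ≤ 2 * |P| / ρ := by positivity
      linarith
    · have h3 : ‖fderiv ℝ v x - fderiv ℝ v y‖ ≤ 2 * |P| := by
        refine (norm_sub_le _ _).trans ?_
        linarith [hP x hx, hP y hy, le_abs_self P]
      have h4 : 2 * |P| ≤ 2 * |P| / ρ * ‖x - y‖ := by
        rw [div_mul_eq_mul_div, le_div_iff₀ hρ]
        exact mul_le_mul_of_nonneg_left hge (by positivity)
      have h5 : 0 ≤ M * ‖x - y‖ := by positivity
      rw [add_mul]
      linarith

namespace RadialKernel

variable (k : RadialKernel n)

theorem avg_congr {U V : EuclideanSpace ℝ (Fin n) → ℝ} {r : ℝ} (hr : 0 < r)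
    {x : EuclideanSpace ℝ (Fin n)} (h : ∀ z ∈ Metric.closedBall x r, U z = V z) :
    k.avg r U x = k.avg r V x := by
  refine integral_congr_ae (.of_forall fun z => ?_)
  by_cases hz : z ∈ Metric.closedBall x r
  · simp only [h z hz]
  · rw [Metric.mem_closedBall, not_le] at hz
    simp only [k.η_scaled_eq_zero hr hz, mul_zero]

/-- Quadratic expansions of a function with the mean value property, relative to an affine
function. -/
theorem exists_harmonic_expansion : ∃ B : ℝ, 0 ≤ B ∧ ∀ {Ω : Set (EuclideanSpace ℝ (Fin n))},
    IsOpen Ω → ∀ {U v : EuclideanSpace ℝ (Fin n) → ℝ}, Integrable U →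
    (∀ᵐ z ∂(volume.restrict Ω), v z = U z) → ∀ {r : ℝ}, 0 < r → ∀ {x : EuclideanSpace ℝ (Fin n)},
    Metric.ball x (2 * r) ⊆ Ω →
    (∀ y ∈ Metric.ball x r, k.avg r U y = v y) →
    ∀ (a : ℝ) (q : EuclideanSpace ℝ (Fin n) →L[ℝ] ℝ) (x₀ : EuclideanSpace ℝ (Fin n)) {N : ℝ}, 0 ≤ N →
    (∀ z ∈ Metric.ball x (2 * r), |v z - (a + q (z - x₀))| ≤ N) →
    ∃ p : EuclideanSpace ℝ (Fin n) →L[ℝ] ℝ, ‖p‖ ≤ B * N / r ∧ ∀ y ∈ Metric.ball x r,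
      |(v y - (a + q (y - x₀))) - (v x - (a + q (x - x₀))) - p (y - x)| ≤
        B * N / r ^ 2 * ‖y - x‖ ^ 2 := by
  obtain ⟨B, hB, hexp⟩ := k.exists_expansion
  refine ⟨B, hB, fun {Ω} hΩo {U v} hU hae {r} hr {x} hxΩ havg a q x₀ {N} hN hbd => ?_⟩
  have hac : Continuous fun z => a + q (z - x₀) := by fun_prop
  -- Truncating outside the double ball is not seen by averages at scale `r` centred in the ball of
  -- radius `r`.
  let V : EuclideanSpace ℝ (Fin n) → ℝ :=
    (Metric.ball x (2 * r)).indicator fun z => U z - (a + q (z - x₀))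
  have hV : Integrable V := by
    refine (integrable_indicator_iff measurableSet_ball).2 (hU.integrableOn.sub ?_)
    exact (hac.continuousOn.integrableOn_compact (isCompact_closedBall x (2 * r))).mono_set
      Metric.ball_subset_closedBall
  obtain ⟨p, hp, hpe⟩ := hexp r hr x V N hN hV (by
    filter_upwards [ae_restrict_of_ae_restrict_of_subset hxΩ hae,
      ae_restrict_mem measurableSet_ball] with z hz hzb
    simp only [V, Set.indicator_of_mem hzb]
    rw [← hz]
    exact hbd z hzb) (fun z hz => Set.indicator_of_notMem hz _)
  have hval : ∀ y ∈ Metric.ball x r, k.avg r V y = v y - (a + q (y - x₀)) := by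
    intro y hy
    have hVU : ∀ z ∈ Metric.closedBall y r, V z = U z - (a + q (z - x₀)) := fun z hz =>
      Set.indicator_of_mem (Metric.mem_ball.2 (by
        linarith [dist_triangle z y x, Metric.mem_ball.1 hy, Metric.mem_closedBall.1 hz])) _
    rw [k.avg_congr hr hVU, ← havg y hy, ← k.avg_affine hr a q x₀ y, avg, avg, avg, ← integral_sub
      (k.integrable_mul_kernel hU r y) (k.integrable_continuous_mul_kernel hr y hac)]
    simp_rw [sub_mul]
  refine ⟨p, hp, fun y hy => ?_⟩
  rw [← hval y hy, ← hval x (Metric.mem_ball_self hr)]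
  exact hpe y

/-- Locally uniform quadratic expansions at all points, given quadratic separation from the tangent
planes of the obstacle at the contact points and the mean value property elsewhere. -/
theorem exists_uniform_expansion {φ U v : EuclideanSpace ℝ (Fin n) → ℝ} (hΩo : IsOpen Ω)
    (hφc : ContinuousOn φ Ω) (hvc : ContinuousOn v Ω) (hφv : ∀ x ∈ Ω, φ x ≤ v x)
    (hU : Integrable U) (hae : ∀ᵐ z ∂(volume.restrict Ω), v z = U z)
    (hharm : ∀ x r, 0 < r → Metric.closedBall x r ⊆ {z ∈ Ω | φ z < v z} → k.avg r U x = v x)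
    {A : ℝ} (hA : 0 ≤ A) (hgrowth : ∀ x ∈ Ω, v x = φ x → ∀ y,
      Metric.closedBall x (4 * dist y x) ⊆ Ω →
      |v y - (φ x + fderiv ℝ φ x (y - x))| ≤ A * ‖y - x‖ ^ 2)
    {K : Set (EuclideanSpace ℝ (Fin n))} (hK : IsCompact K) (hKΩ : K ⊆ Ω) :
    ∃ M ρ : ℝ, 0 ≤ M ∧ 0 < ρ ∧ ∀ x ∈ K, ∃ p : EuclideanSpace ℝ (Fin n) →L[ℝ] ℝ,
      ∀ y ∈ Metric.ball x ρ, |v y - v x - p (y - x)| ≤ M * ‖y - x‖ ^ 2 := by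
  obtain ⟨B, hB, hexp⟩ := k.exists_harmonic_expansion
  obtain ⟨δ, hδ, hδΩ⟩ := hK.exists_cthickening_subset_open hΩo hKΩ
  obtain ⟨N, hN⟩ := (hK.cthickening (r := δ)).exists_bound_of_continuousOn (hvc.mono hδΩ)
  -- For a contact point within `2ρ` of `x` and `z` within `4ρ` of it, the ball required by the
  -- growth estimate lies within `4·4ρ + 2ρ = 18ρ ≤ δ` of `x`.
  set ρ := δ / 20 with hρdef
  have hρ : 0 < ρ := by positivity
  have hball : ∀ x ∈ K, Metric.closedBall x δ ⊆ Metric.cthickening δ K := fun x hx =>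
    Metric.closedBall_subset_cthickening hx δ
  -- `13A = 9A + 4A` comes from points `y` at distance at least `d/2`, `16AB` from the rescaled
  -- harmonic estimate, and the last term from balls free of contact points.
  refine ⟨13 * A + 16 * (A * B) + B * |N| / ρ ^ 2, ρ, by positivity, hρ, fun x hx => ?_⟩
  have hAB : 0 ≤ A * B := mul_nonneg hA hB
  have hBN : 0 ≤ B * |N| / ρ ^ 2 := by positivity
  have hxδ := (hball x hx).trans hδΩ
  have hx2 : Metric.closedBall x (2 * ρ) ⊆ Ω :=
    (Metric.closedBall_subset_closedBall (by linarith)).trans hxδ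
  -- the growth estimate is available near contact points close to `x`
  have hg : ∀ x₀, dist x₀ x ≤ 2 * ρ → v x₀ = φ x₀ → ∀ z, dist z x₀ ≤ 4 * ρ →
      |v z - (φ x₀ + fderiv ℝ φ x₀ (z - x₀))| ≤ A * dist z x₀ ^ 2 := by
    intro x₀ h1 h2 z h3
    rw [dist_eq_norm z x₀]
    refine hgrowth x₀ (hx2 (Metric.mem_closedBall.2 h1)) h2 z
      ((Metric.closedBall_subset_closedBall' ?_).trans hxδ)
    linarith
  by_cases hxc : v x = φ x
  · refine ⟨fderiv ℝ φ x, fun y hy => ?_⟩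
    have := hg x (by rw [dist_self]; positivity) hxc y (by linarith [Metric.mem_ball.1 hy])
    rw [hxc, sub_sub, ← dist_eq_norm]
    refine this.trans (mul_le_mul_of_nonneg_right ?_ (sq_nonneg _))
    linarith
  set S := {z ∈ Metric.closedBall x (2 * ρ) | v z = φ z} with hS
  have hmemN : ∀ z ∈ Metric.closedBall x (2 * ρ), z ∉ S → z ∈ {z ∈ Ω | φ z < v z} := by
    intro z hz hzS
    exact ⟨hx2 hz, lt_of_le_of_ne (hφv z (hx2 hz)) fun h => hzS ⟨hz, h.symm⟩⟩
  rcases S.eq_empty_or_nonempty with hSe | hSne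
  · obtain ⟨p, -, hp⟩ := hexp hΩo hU hae hρ (x := x) (Metric.ball_subset_closedBall.trans hx2)
      (fun y hy => hharm y ρ hρ fun z hz => hmemN z (Metric.mem_closedBall.2 (by
        linarith [dist_triangle z y x, Metric.mem_ball.1 hy, Metric.mem_closedBall.1 hz]))
        (by simp [hSe]))
      0 0 0 (abs_nonneg N) (fun z hz => by
        have := hN z (hball x hx (Metric.mem_closedBall.2 (by linarith [Metric.mem_ball.1 hz])))
        simpa using this.trans (le_abs_self N))
    refine ⟨p, fun y hy => ?_⟩
    have := hp y hy
    simp only [zero_apply, add_zero, sub_zero] at this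
    refine this.trans (mul_le_mul_of_nonneg_right ?_ (sq_nonneg _))
    linarith
  · have hScl : IsClosed S := by
      have h1 : ContinuousOn (fun z => v z - φ z) (Metric.closedBall x (2 * ρ)) :=
        (hvc.sub hφc).mono hx2
      have h2 := h1.preimage_isClosed_of_isClosed Metric.isClosed_closedBall
        (isClosed_singleton (x := (0 : ℝ)))
      convert h2 using 1
      ext z
      simp [hS, sub_eq_zero]
    have hSc : IsCompact S := (isCompact_closedBall x (2 * ρ)).of_isClosed_subset hScl
      (Set.sep_subset _ _)
    -- At a nearest contact point, the open ball of radius `d` about `x` is free of contact, while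
    -- `v` minus the tangent plane at `x₀` is at most `A(2d)²` on it.
    obtain ⟨x₀, hx₀S, hmin⟩ := hSc.exists_isMinOn hSne
      (continuous_id.dist (continuous_const (y := x))).continuousOn
    have hx₀2 : dist x₀ x ≤ 2 * ρ := Metric.mem_closedBall.1 hx₀S.1
    have hx₀c : v x₀ = φ x₀ := hx₀S.2
    set d := dist x₀ x with hd
    have hd0 : 0 < d := dist_pos.2 fun h => hxc (h ▸ hx₀c)
    have hr : 0 < d / 2 := by positivity
    have h2r : 2 * (d / 2) = d := by ring
    have hbx : Metric.ball x d ⊆ Metric.closedBall x (2 * ρ) :=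
      (Metric.ball_subset_ball hx₀2).trans Metric.ball_subset_closedBall
    have hbN : Metric.ball x d ⊆ {z ∈ Ω | φ z < v z} := fun z hz => by
      refine hmemN z (hbx hz) fun hzS => ?_
      have : d ≤ dist z x := hmin hzS
      exact absurd (Metric.mem_ball.1 hz) (not_lt.2 this)
    set q := fderiv ℝ φ x₀ with hq
    obtain ⟨p, hpn, hp⟩ := hexp hΩo hU hae hr (x := x)
      (by rw [h2r]; exact hbx.trans hx2)
      (fun y hy => hharm y (d / 2) hr fun z hz => hbN (Metric.mem_ball.2 (by
        linarith [dist_triangle z y x, Metric.mem_ball.1 hy, Metric.mem_closedBall.1 hz])))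
      (φ x₀) q x₀ (N := A * (2 * d) ^ 2) (by positivity) (fun z hz => by
        rw [h2r, Metric.mem_ball] at hz
        have hz' : dist z x₀ ≤ 2 * d := by
          linarith [dist_triangle z x x₀, dist_comm x x₀]
        refine (hg x₀ hx₀2 hx₀c z (by linarith)).trans ?_
        gcongr)
    refine ⟨q + p, fun y hy => ?_⟩
    have hlin : v y - v x - (q + p) (y - x) = (v y - (φ x₀ + q (y - x₀))) -
        (v x - (φ x₀ + q (x - x₀))) - p (y - x) := by
      have : q (y - x) = q (y - x₀) - q (x - x₀) := by
        rw [← map_sub]; congr 1; abel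
      rw [add_apply, this]
      ring
    rw [hlin]
    have hyρ : dist y x < ρ := Metric.mem_ball.1 hy
    rcases lt_or_ge (dist y x) (d / 2) with hlt | hge
    · refine (hp y hlt).trans (mul_le_mul_of_nonneg_right ?_ (sq_nonneg _))
      have : B * (A * (2 * d) ^ 2) / (d / 2) ^ 2 = 16 * (A * B) := by
        field_simp
        ring
      rw [this]
      linarith
    -- For `|y - x| ≥ d/2`, the distances of `x` and `y` to `x₀` are at most `2|y - x|` and `3|y -
    -- x|`. Hence the growth estimate at `x₀` and the bound on `p` suffice, without harmonicity at
    -- `y`.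
    · have hyx₀ : dist y x₀ ≤ 3 * dist y x := by
        linarith [dist_triangle y x x₀, dist_comm x x₀]
      have hxx₀ : dist x x₀ ≤ 2 * dist y x := by
        rw [dist_comm x x₀]; linarith
      have t1 : |v y - (φ x₀ + q (y - x₀))| ≤ A * (3 * dist y x) ^ 2 :=
        (hg x₀ hx₀2 hx₀c y (by linarith)).trans (by gcongr)
      have t2 : |v x - (φ x₀ + q (x - x₀))| ≤ A * (2 * dist y x) ^ 2 :=
        (hg x₀ hx₀2 hx₀c x (by rw [dist_comm]; linarith)).trans (by gcongr)
      have t3 : |p (y - x)| ≤ 16 * (A * B) * dist y x ^ 2 := by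
        have e : B * (A * (2 * d) ^ 2) / (d / 2) = 8 * (A * B) * d := by
          field_simp
          ring
        rw [e] at hpn
        have := p.le_of_opNorm_le hpn (y - x)
        rw [Real.norm_eq_abs, ← dist_eq_norm] at this
        refine this.trans ?_
        have h5 : d * dist y x ≤ 2 * dist y x * dist y x := by
          have := dist_nonneg (x := y) (y := x)
          gcongr
          linarith
        nlinarith [mul_le_mul_of_nonneg_left h5 hAB]
      have t4 : 0 ≤ B * |N| / ρ ^ 2 * dist y x ^ 2 := by positivity
      rw [← dist_eq_norm]
      have t5 := abs_sub (v y - (φ x₀ + q (y - x₀)) - (v x - (φ x₀ + q (x - x₀)))) (p (y - x))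
      have t6 := abs_sub (v y - (φ x₀ + q (y - x₀))) (v x - (φ x₀ + q (x - x₀)))
      linarith

end RadialKernel

end QuadraticExpansions

/-! ### From the minimizer to the hypotheses of the regularity argument. -/

section Regularity

variable {n : ℕ} {Ω : Set (EuclideanSpace ℝ (Fin n))}

theorem le_on_of_ae_le (hΩo : IsOpen Ω) {φ v : EuclideanSpace ℝ (Fin n) → ℝ}
    (hφ : ContinuousOn φ Ω) (hv : ContinuousOn v Ω)
    (h : ∀ᵐ x ∂(volume.restrict Ω), φ x ≤ v x) {x : EuclideanSpace ℝ (Fin n)} (hx : x ∈ Ω) :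
    φ x ≤ v x := by
  by_contra hlt
  rw [not_le] at hlt
  have hnhds : {z | v z < φ z} ∩ Ω ∈ 𝓝 x := by
    refine inter_mem ?_ (hΩo.mem_nhds hx)
    exact (hv.continuousAt (hΩo.mem_nhds hx)).eventually_lt
      (hφ.continuousAt (hΩo.mem_nhds hx)) hlt
  have hpos := Measure.measure_pos_of_mem_nhds volume hnhds
  have h0 : volume ({z | v z < φ z} ∩ Ω) = 0 := by
    refine measure_mono_null (fun z hz => ?_) ((ae_restrict_iff' hΩo.measurableSet).1 h)
    simp only [Set.mem_compl_iff, Set.mem_ofPred_eq, Classical.not_imp, not_le]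
    exact ⟨hz.2, hz.1⟩
  exact hpos.ne' h0

/-- The average of a function with values in a closed ball stays in that ball, by convexity;
continuity of `v` makes the ball small. -/
theorem tendsto_average_of_ae_eq (hΩo : IsOpen Ω) {u v : EuclideanSpace ℝ (Fin n) → ℝ}
    (hv : ContinuousOn v Ω) (hae : ∀ᵐ x ∂(volume.restrict Ω), v x = u x)
    {x : EuclideanSpace ℝ (Fin n)} (hx : x ∈ Ω) :
    Tendsto (fun r : ℝ => ⨍ y in Metric.ball x r, u y) (𝓝[>] 0) (𝓝 (v x)) := by
  rw [Metric.tendsto_nhds]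
  intro ε hε
  obtain ⟨δ, hδ, hδε⟩ := Metric.nhds_basis_closedBall.mem_iff.1
    (inter_mem ((hv.continuousAt (hΩo.mem_nhds hx)).preimage_mem_nhds
      (Metric.closedBall_mem_nhds (v x) (half_pos hε))) (hΩo.mem_nhds hx))
  filter_upwards [Ioo_mem_nhdsGT hδ] with r hr
  have hsub : Metric.ball x r ⊆ Metric.closedBall x δ :=
    (Metric.ball_subset_ball hr.2.le).trans Metric.ball_subset_closedBall
  have hsubΩ : Metric.closedBall x δ ⊆ Ω := fun z hz => (hδε hz).2
  have heq : (fun y => u y) =ᵐ[volume.restrict (Metric.ball x r)] v := by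
    filter_upwards [ae_restrict_of_ae_restrict_of_subset (hsub.trans hsubΩ) hae] with z hz
    exact hz.symm
  rw [average_congr heq]
  have hmem : ⨍ y in Metric.ball x r, v y ∈ Metric.closedBall (v x) (ε / 2) := by
    refine (convex_closedBall _ _).set_average_mem Metric.isClosed_closedBall
      (Metric.measure_ball_pos _ _ hr.1).ne' measure_ball_lt_top.ne ?_ ?_
    · exact ae_restrict_of_forall_mem measurableSet_ball fun z hz => (hδε (hsub hz)).1
    · exact ((hv.mono hsubΩ).integrableOn_compact (isCompact_closedBall x δ)).mono_set hsub
  exact (Metric.mem_closedBall.1 hmem).trans_lt (half_lt_self hε)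

theorem IsC11LocOn.sub_isC11On (hΩo : IsOpen Ω) {v φ : EuclideanSpace ℝ (Fin n) → ℝ}
    (hv : IsC11LocOn v Ω) (hφ : IsC11On φ Ω) : IsC11LocOn (fun x => v x - φ x) Ω := by
  obtain ⟨hφ1, L, hL⟩ := hφ
  refine ⟨hv.1.sub hφ1, fun K hK hKΩ => ?_⟩
  obtain ⟨C, hC⟩ := hv.2 K hK hKΩ
  have he : ∀ x ∈ K, fderiv ℝ (fun x => v x - φ x) x = fderiv ℝ v x - fderiv ℝ φ x :=
    fun x hx => by
      have hn := hΩo.mem_nhds (hKΩ hx)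
      have h : HasFDerivAt (fun x => v x - φ x) (fderiv ℝ v x - fderiv ℝ φ x) x :=
        ((hv.1.contDiffAt hn).differentiableAt one_ne_zero).hasFDerivAt.sub
          ((hφ1.contDiffAt hn).differentiableAt one_ne_zero).hasFDerivAt
      exact h.fderiv
  refine ⟨C + L, LipschitzOnWith.of_dist_le_mul fun x hx y hy => ?_⟩
  rw [he x hx, he y hy]
  refine (dist_sub_sub_le _ _ _ _).trans ?_
  push_cast
  rw [add_mul]
  exact add_le_add (hC.dist_le_mul x hx y hy) (hL.dist_le_mul x (hKΩ hx) y (hKΩ hy))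

theorem IsAdmissible.integral_indicator_mul_lap (hΩo : IsOpen Ω) (hΩb : Bornology.IsBounded Ω)
    {φ f u : EuclideanSpace ℝ (Fin n) → ℝ}
    {gu : EuclideanSpace ℝ (Fin n) → EuclideanSpace ℝ (Fin n)} (hadm : IsAdmissible Ω φ f u gu)
    {ψ : EuclideanSpace ℝ (Fin n) → ℝ} (hψ : ContDiff ℝ ∞ ψ) (hc : HasCompactSupport ψ)
    (hs : tsupport ψ ⊆ Ω) :
    ∫ x, Ω.indicator u x * lap ψ x = - ∫ x in Ω, inner ℝ (gu x) (gradient ψ x) := by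
  rw [hadm.isW12.isWeakGradient.integral_inner_gradient hΩo hΩb hadm.isW12.memLp
    hadm.isW12.memLp_grad hψ hc hs, neg_neg, ← integral_indicator hΩo.measurableSet]
  refine integral_congr_ae (.of_forall fun x => ?_)
  simp only
  by_cases hx : x ∈ Ω
  · rw [Set.indicator_of_mem hx, Set.indicator_of_mem hx]
  · rw [Set.indicator_of_notMem hx, Set.indicator_of_notMem hx, zero_mul]

/-- Extension by zero makes `u` integrable on the whole space, where the averages are defined; test
functions supported in `Ω` do not notice it. -/
theorem weakLapBounds_of_isMinimizer (hΩo : IsOpen Ω) (hΩb : Bornology.IsBounded Ω)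
    {φ f u : EuclideanSpace ℝ (Fin n) → ℝ}
    {gu : EuclideanSpace ℝ (Fin n) → EuclideanSpace ℝ (Fin n)} (hadm : IsAdmissible Ω φ f u gu)
    (hmin : ∀ w gw, IsAdmissible Ω φ f w gw →
      ∫ x in Ω, ‖gu x‖ ^ 2 / 2 ≤ ∫ x in Ω, ‖gw x‖ ^ 2 / 2)
    (hφ : ContDiffOn ℝ 1 φ Ω) {L : ℝ≥0} (hL : LipschitzOnWith L (fderiv ℝ φ) Ω) :
    WeakLapBounds Ω (Ω.indicator u) (n * L) where
  integrable := by
    have : IsFiniteMeasure (volume.restrict Ω) :=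
      isFiniteMeasure_restrict.2 hΩb.measure_lt_top.ne
    exact (integrable_indicator_iff hΩo.measurableSet).2
      (hadm.isW12.memLp.integrable (by norm_num))
  const_nonneg := by positivity
  nonpos ψ hψ hc hs h0 := by
    rw [hadm.integral_indicator_mul_lap hΩo hΩb hψ hc hs, neg_nonpos]
    refine integral_inner_gradient_nonneg_of_isMinimizer hΩo hΩb hadm hmin (hψ.of_le (by simp)) hs
      one_pos fun t ht _ => ?_
    filter_upwards [hadm.obstacle_le] with x hx
    have := mul_nonneg ht.le (h0 x)
    linarith
  ge ψ hψ hc hs h0 := by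
    rw [hadm.integral_indicator_mul_lap hΩo hΩb hψ hc hs, neg_le_neg_iff]
    exact integral_inner_gradient_le_of_isMinimizer hΩo hΩb hadm hmin hφ hL hψ hc hs h0

/-- The minimizer is harmonic away from the contact set. -/
theorem integral_mul_lap_eq_zero_of_isMinimizer (hΩo : IsOpen Ω) (hΩb : Bornology.IsBounded Ω)
    {φ f u v : EuclideanSpace ℝ (Fin n) → ℝ}
    {gu : EuclideanSpace ℝ (Fin n) → EuclideanSpace ℝ (Fin n)} (hadm : IsAdmissible Ω φ f u gu)
    (hmin : ∀ w gw, IsAdmissible Ω φ f w gw →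
      ∫ x in Ω, ‖gu x‖ ^ 2 / 2 ≤ ∫ x in Ω, ‖gw x‖ ^ 2 / 2)
    (hφ : ContinuousOn φ Ω) (hv : ContinuousOn v Ω)
    (hae : ∀ᵐ x ∂(volume.restrict Ω), v x = u x)
    {ψ : EuclideanSpace ℝ (Fin n) → ℝ} (hψ : ContDiff ℝ ∞ ψ) (hc : HasCompactSupport ψ)
    (hs : tsupport ψ ⊆ {x ∈ Ω | φ x < v x}) : ∫ x, Ω.indicator u x * lap ψ x = 0 := by
  have hsΩ : tsupport ψ ⊆ Ω := hs.trans (Set.sep_subset _ _)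
  -- By compactness `v - φ` has a positive minimum on the support, leaving room for small variations
  -- of either sign. Applying `key` to `ψ` and `-ψ` then yields equality.
  obtain ⟨m, hm0, hm⟩ : ∃ m : ℝ, 0 < m ∧ ∀ x ∈ tsupport ψ, m ≤ v x - φ x := by
    rcases (tsupport ψ).eq_empty_or_nonempty with he | hne
    · exact ⟨1, one_pos, by simp [he]⟩
    · obtain ⟨x₀, hx₀, hmin₀⟩ := hc.isCompact.exists_isMinOn hne ((hv.sub hφ).mono hsΩ)
      exact ⟨v x₀ - φ x₀, sub_pos.2 (hs hx₀).2, fun x hx => hmin₀ hx⟩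
  obtain ⟨M, hM⟩ := hc.exists_bound_of_continuous hψ.continuous
  have hM0 : 0 ≤ M := (norm_nonneg _).trans (hM 0)
  have key : ∀ ψ' : EuclideanSpace ℝ (Fin n) → ℝ, ContDiff ℝ ∞ ψ' → tsupport ψ' ⊆ tsupport ψ →
      (∀ x, ‖ψ' x‖ ≤ M) → 0 ≤ ∫ x in Ω, inner ℝ (gu x) (gradient ψ' x) := by
    intro ψ' hψ' hs' hM'
    refine integral_inner_gradient_nonneg_of_isMinimizer hΩo hΩb hadm hmin
      (hψ'.of_le (by simp)) (hs'.trans hsΩ) (t₀ := m / (M + 1)) (by positivity) fun t ht htm => ?_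
    filter_upwards [hadm.obstacle_le, hae] with x hx hvx
    by_cases hxs : x ∈ tsupport ψ
    · have h1 := hm x hxs
      have h2 := (abs_le.1 (hM' x)).1
      have h3 : t * (M + 1) ≤ m := (le_div_iff₀ (by positivity)).1 htm
      rw [← hvx]
      nlinarith
    · rw [image_eq_zero_of_notMem_tsupport fun h => hxs (hs' h)]
      simpa using hx
  have h1 := key ψ hψ le_rfl hM
  have h2 := key (fun x => -ψ x) hψ.neg
    (closure_mono (by intro x hx; simpa using hx)) (by simpa using hM)
  have h3 : ∀ x, gradient (fun x => -ψ x) x = - gradient ψ x := by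
    intro x
    rw [gradient, gradient, fderiv_fun_neg, map_neg]
  simp_rw [h3, inner_neg_right] at h2
  rw [integral_neg] at h2
  rw [hadm.integral_indicator_mul_lap hΩo hΩb hψ hc hsΩ]
  linarith

end Regularity

end ObstacleProblem

theorem mainTheorem1 {n : ℕ} (hn : 1 ≤ n)
    (Ω : Set (EuclideanSpace ℝ (Fin n))) (hΩ : ObstacleProblem.IsBoundedC1Domain Ω)
    (φ : EuclideanSpace ℝ (Fin n) → ℝ) (hφ : ContDiffOn ℝ 1 φ (closure Ω))
    (f : EuclideanSpace ℝ (Fin n) → ℝ) (hf : ContDiffOn ℝ 1 f (frontier Ω))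
    (hφf : ∀ x ∈ frontier Ω, φ x ≤ f x)
    (u : EuclideanSpace ℝ (Fin n) → ℝ) (hu : ObstacleProblem.IsMinimizer Ω φ f u)
    (hφ11 : ObstacleProblem.IsC11On φ Ω) :
    ∃ u' : EuclideanSpace ℝ (Fin n) → ℝ,
      ObstacleProblem.IsPreciseRepresentative Ω u u' ∧
      ObstacleProblem.IsC11LocOn (fun x => u' x - φ x) Ω ∧
      ObstacleProblem.IsC11LocOn u' Ω := by
  obtain ⟨gu, hadm, hmin⟩ := hu
  have hΩo := hΩ.isOpen
  have hΩb := hΩ.isBounded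
  obtain ⟨hφ1, L, hL⟩ := id hφ11
  have hU := ObstacleProblem.weakLapBounds_of_isMinimizer hΩo hΩb hadm hmin hφ1 hL
  obtain ⟨k⟩ := ObstacleProblem.nonempty_radialKernel n
  obtain ⟨v, hv⟩ := k.exists_representative hΩo hU
  have hvc := k.continuousOn_representative hΩo hU hv
  have haeU := k.representative_ae_eq hΩo hU.integrable hv
  have hae : ∀ᵐ x ∂(volume.restrict Ω), v x = u x := by
    filter_upwards [haeU, ae_restrict_mem hΩo.measurableSet] with x hx hxΩ
    rw [hx, Set.indicator_of_mem hxΩ]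
  have hφU : ∀ᵐ x ∂(volume.restrict Ω), φ x ≤ Ω.indicator u x := by
    filter_upwards [hadm.obstacle_le, ae_restrict_mem hΩo.measurableSet] with x hx hxΩ
    rwa [Set.indicator_of_mem hxΩ]
  have hφv : ∀ x ∈ Ω, φ x ≤ v x := fun x hx =>
    ObstacleProblem.le_on_of_ae_le hΩo hφ1.continuousOn hvc (by
      filter_upwards [hadm.obstacle_le, hae] with z hz hz'
      rwa [hz']) hx
  obtain ⟨A, hA, hgrowth⟩ := k.exists_abs_sub_tangent_le hΩo hφ1 hL hU hφU hv hφv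
  have hharm : ∀ x r, 0 < r → Metric.closedBall x r ⊆ {z ∈ Ω | φ z < v z} →
      k.avg r (Ω.indicator u) x = v x := by
    intro x r hr hsub
    refine k.avg_eq_representative hU.integrable
      (hv x (hsub (Metric.mem_closedBall_self hr.le)).1) hr fun t ht htr => ?_
    exact ObstacleProblem.integral_mul_lap_eq_zero_of_isMinimizer hΩo hΩb hadm hmin
      hφ1.continuousOn hvc hae (k.contDiff_bump t x) (k.hasCompactSupport_bump ht x)
      ((k.tsupport_bump_subset ht x).trans
        ((Metric.closedBall_subset_closedBall htr).trans hsub))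
  have hreg : ObstacleProblem.IsC11LocOn v Ω :=
    ObstacleProblem.isC11LocOn_of_expansion hΩo fun K hK hKΩ =>
      k.exists_uniform_expansion hΩo hφ1.continuousOn hvc hφv hU.integrable haeU hharm hA hgrowth
        hK hKΩ
  exact ⟨v, ⟨fun x hx => ObstacleProblem.tendsto_average_of_ae_eq hΩo hvc hae hx, hae⟩,
    hreg.sub_isC11On hΩo hφ11, hreg⟩
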